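/- Let $G=(V,E)$ be a connected finite simple graph with $n=|V|\ge 1$ and clique number $\omega(G)$. For distinct $u,v\in V$ let $I(u,v)$ be the set of vertices lying on some induced path between $u$ and $v$, and let $I(u,u)=\emptyset$. A set $X\subseteq V$ is m-convex if $I(u,v)\subseteq X$ for all $u,v\in X$, and $H\subseteq V$ is an m-halfspace if both $H$ and $V\setminus H$ are m-convex; $\mathcal{H}_{\mathrm{mp}}(G)$ denotes the set of m-halfspaces of $G$. The error of $H\subseteq V$ under a distribution $D$ on $V\times\{0,1\}$ is $\Pr_{(x,y)\sim D}[y\neq \mathbf{1}_{x\in H}]$, and $D$ is realizable if some $H^*\in\mathcal{H}_{\mathrm{mp}}(G)$ has error $0$ under $D$. **Theorem.** There exist a deterministic algorithm $\mathcal{A}$ (a program of a random access machine with addition and subtraction), a polynomial $p$ and constants $c\in\mathbb{N}$ and $C>0$ such that the following holds for every connected graph $G$ on $V=\{0,\dots,n-1\}$. 1. Given the adjacency matrix of $G$ and a sequence $(S,y)$ of $m$ labeled examples from $V\times\{0,1\}$, the algorithm halts after at most $p(n)+c\,m$ steps, that is, in time $\mathrm{poly}(n)$ apart from constant time per example for reading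 the sample, and outputs a set $\mathcal{A}(G,S,y)\subseteq V$. 2. For all $\varepsilon,\delta\in(0,1)$ and every integer $$m\;\ge\; C\cdot\frac{\omega(G)\log(2/\varepsilon)+\log(1/\delta)}{\varepsilon},$$ the algorithm $(\varepsilon,\delta)$-PAC learns $(V,\mathcal{H}_{\mathrm{mp}}(G))$ in the realizable setting from $m$ labeled examples: its output on $m$ examples is always an m-halfspace of $G$, and for every realizable distribution $D$ on $V\times\{0,1\}$, if the $m$ examples are drawn independently from $D$, then with probability at least $1-\delta$ the output has error at most $\varepsilon$ under $D$. -/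

import Mathlib

open MeasureTheory

noncomputable section

namespace MonoPAC

/-! ### Monophonic halfspaces -/

/-- The monophonic interval `I(u,v)`: the vertices lying on some induced (chordless) path between
the distinct vertices `u` and `v`; `I(u,u) = ∅`. -/
def mInterval {V : Type*} (G : SimpleGraph V) (u v : V) : Set V :=
  {z | u ≠ v ∧ ∃ w : G.Walk u v, w.IsPath ∧ w.toSubgraph.IsInduced ∧ z ∈ w.support}

/-- Monophonically convex sets. -/
def MConvex {V : Type*} (G : SimpleGraph V) (X : Set V) : Prop :=
  ∀ u ∈ X, ∀ v ∈ X, mInterval G u v ⊆ X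

/-- The class of monophonic halfspaces of `G`. -/
def mHalfspaces {V : Type*} (G : SimpleGraph V) : Set (Set V) :=
  {H | MConvex G H ∧ MConvex G Hᶜ}

/-! ### PAC learning in the realizable setting -/

/-- The error of the hypothesis `H` under the joint distribution `D` of vertices and labels: the
probability that the label differs from the indicator of `H`. -/
def error {V : Type*} [MeasurableSpace V] (D : Measure (V × Bool)) (H : Set V) : ℝ :=
  D.real {z | ¬ (z.2 = true ↔ z.1 ∈ H)}

/-- `A`, run on `m` independent labeled examples, `(ε, δ)`-PAC learns the class `𝓗` in the
realizable setting: it always outputs a member of `𝓗`, and for every joint distribution `D` of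
vertices and labels that is realized by a member of `𝓗`, the output has error at most `ε` with
probability at least `1 - δ`. -/
def PACLearnsRealizable {V : Type*} [MeasurableSpace V] (𝓗 : Set (Set V)) (m : ℕ)
    (A : (Fin m → V × Bool) → Set V) (ε δ : ℝ) : Prop :=
  (∀ S, A S ∈ 𝓗) ∧
  ∀ D : Measure (V × Bool), IsProbabilityMeasure D → (∃ H ∈ 𝓗, error D H = 0) →
    1 - δ ≤ (Measure.pi fun _ : Fin m => D).real {S | error D (A S) ≤ ε}

/-! ### Computation model

A random access machine with structured programs. A program uses scalar variables and arrays, all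
holding natural numbers; it mentions only finitely many of them by name, and array cells are
addressed by computed indices. The only arithmetic is addition and truncated subtraction, so that
unit cost is polynomially equivalent to bit cost. -/

/-- Arithmetic expressions; `read a e` is the content of cell `e` of array `a`. -/
inductive Expr : Type
  | const : ℕ → Expr
  | var : ℕ → Expr
  | read : ℕ → Expr → Expr
  | add : Expr → Expr → Expr
  | sub : Expr → Expr → Expr

/-- Programs. `store a i e` writes `e` into cell `i` of array `a`; tests succeed when the
expression is nonzero. -/
inductive Cmd : Type
  | skip : Cmd
  | assign : ℕ → Expr → Cmd
  | store : ℕ → Expr → Expr → Cmd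
  | seq : Cmd → Cmd → Cmd
  | ite : Expr → Cmd → Cmd → Cmd
  | loop : Expr → Cmd → Cmd

/-- Memory contents. -/
structure State where
  var : ℕ → ℕ
  arr : ℕ → ℕ → ℕ

/-- The value of an expression. -/
def Expr.eval (s : State) : Expr → ℕ
  | .const k => k
  | .var x => s.var x
  | .read a e => s.arr a (e.eval s)
  | .add e f => e.eval s + f.eval s
  | .sub e f => e.eval s - f.eval s

/-- The number of elementary operations in the evaluation of an expression. -/
def Expr.cost : Expr → ℕ
  | .const _ => 1
  | .var _ => 1
  | .read _ e => e.cost + 1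
  | .add e f => e.cost + f.cost + 1
  | .sub e f => e.cost + f.cost + 1

/-- `Runs c s s' t`: the program `c`, started in memory `s`, halts with memory `s'` after exactly
`t` steps. -/
inductive Runs : Cmd → State → State → ℕ → Prop
  | skip (s : State) : Runs .skip s s 1
  | assign (x : ℕ) (e : Expr) (s : State) :
      Runs (.assign x e) s ⟨Function.update s.var x (e.eval s), s.arr⟩ (e.cost + 1)
  | store (a : ℕ) (i e : Expr) (s : State) :
      Runs (.store a i e) s
        ⟨s.var, Function.update s.arr a (Function.update (s.arr a) (i.eval s) (e.eval s))⟩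
        (i.cost + e.cost + 1)
  | seq {c d : Cmd} {s s' s'' : State} {t t' : ℕ} :
      Runs c s s' t → Runs d s' s'' t' → Runs (.seq c d) s s'' (t + t')
  | ite_true {e : Expr} {c d : Cmd} {s s' : State} {t : ℕ} :
      e.eval s ≠ 0 → Runs c s s' t → Runs (.ite e c d) s s' (e.cost + 1 + t)
  | ite_false {e : Expr} {c d : Cmd} {s s' : State} {t : ℕ} :
      e.eval s = 0 → Runs d s s' t → Runs (.ite e c d) s s' (e.cost + 1 + t)
  | loop_true {e : Expr} {c : Cmd} {s s' s'' : State} {t t' : ℕ} :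
      e.eval s ≠ 0 → Runs c s s' t → Runs (.loop e c) s' s'' t' →
      Runs (.loop e c) s s'' (e.cost + 1 + t + t')
  | loop_false {e : Expr} {c : Cmd} {s : State} :
      e.eval s = 0 → Runs (.loop e c) s s (e.cost + 1)

open Classical in
/-- The input memory for a graph on `{0, …, n-1}` and a sequence of `m` labeled examples.
Variables `0` and `1` hold `n` and `m`; array `0` holds the adjacency matrix in row-major order;
arrays `1` and `2` hold the vertices and the labels of the examples. All other memory is zero. -/
def inputState {n m : ℕ} (G : SimpleGraph (Fin n)) (S : Fin m → Fin n × Bool) : State where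
  var x := match x with
    | 0 => n
    | 1 => m
    | _ => 0
  arr a k := match a with
    | 0 => if ∃ i j : Fin n, G.Adj i j ∧ k = i * n + j then 1 else 0
    | 1 => if h : k < m then ((S ⟨k, h⟩).1 : ℕ) else 0
    | 2 => if h : k < m then (S ⟨k, h⟩).2.toNat else 0
    | _ => 0

/-- The vertex set that a program leaves as its output: array `3` is its indicator vector. -/
def outputSet (n : ℕ) (s : State) : Set (Fin n) :=
  {v | s.arr 3 v = 1}

/-- On the input `(G, S)` the program `P` halts after at most `T` steps with output `H`. -/
def OutputsInTime (P : Cmd) {n m : ℕ} (G : SimpleGraph (Fin n)) (S : Fin m → Fin n × Bool)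
    (H : Set (Fin n)) (T : ℕ) : Prop :=
  ∃ s t, Runs P (inputState G S) s t ∧ t ≤ T ∧ outputSet n s = H

end MonoPAC

end

noncomputable section

namespace MonoPAC

/-! ### A language of bounded loops -/

/-! In a connected graph, a set is an m-halfspace exactly when the border of each of its two sides
is a clique (`mem_mHalfspaces_iff`). A chordless path that leaves a side and returns would have a
chord between its exit and re-entry vertices. Conversely, two nonadjacent border vertices of one
side are joined by a chordless path through the other side. The learner and its sample bound both
rest on this description.

Sample size. If 2ω + 2 points were shattered, pair them up and take a halfspace that separates every
pair. Chordless paths between the partners then supply ω + 1 distinct border vertices, which form a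
clique. So shattered families have at most 2ω + 1 members (`card_le_of_shattered`). The
double-sample argument with the Sauer–Shelah lemma then shows that any learner that outputs
halfspaces, and a consistent one whenever one exists, has the required sample complexity
(`pacLearns_of_consistent`).

Running time. A consistent halfspace that is neither empty nor full cuts some edge uv, with u inside
and v outside, so all ordered edges are tried. For a fixed edge the border condition is a family of
clauses with four literals, one family per side. Choosing u and v already decides the vertices
adjacent to exactly one of them. Keeping only those binary clauses that arise when two of the four
literals are decided in this way loses nothing (`border_of_pairs`), so the task becomes 2-SAT. It is
solved by closing the conflict relation under resolution in one pass over the pivots and then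
setting literals true greedily (`closeConf_spec`, `greedy_spec`, `solve_spec`). If no edge works,
only the empty and the full set remain.

Implementation. The program is written in a language of bounded loops whose semantics is a function
on memories, so correctness is proved by loop invariants. A translation into the machine transfers
both the result and the cost bound (`compile_runs`). Only the loop that reads the examples is
bounded by m; all others are bounded by n or 2n, which gives a polynomial in n plus a constant per
example. -/

/-- Memory contents of the arrays. -/
abbrev Mem := ℕ → ℕ → ℕ

/-- Writing one array cell. -/
def Mem.set (M : Mem) (a k v : ℕ) : Mem :=
  Function.update M a (Function.update (M a) k v)

/-- Programs with bounded loops only; `loop N c` runs `c` once for each value below the variable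
`N` of the loop variable, which is variable `3 + d` for a loop nested inside `d` others. -/
inductive Prog : Type
  | store : ℕ → Expr → Expr → Prog
  | seq : Prog → Prog → Prog
  | cond : Expr → Prog → Prog
  | loop : ℕ → Prog → Prog

/-- All variables of the expression are below `k`. -/
def Expr.Below (k : ℕ) : Expr → Prop
  | .const _ => True
  | .var x => x < k
  | .read _ e => e.Below k
  | .add e f => e.Below k ∧ f.Below k
  | .sub e f => e.Below k ∧ f.Below k

namespace Prog

/-- Translation into a random access machine program, at loop depth `d`. -/
def compile (d : ℕ) : Prog → Cmd
  | .store a i e => .store a i e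
  | .seq p q => .seq (p.compile d) (q.compile d)
  | .cond e p => .ite e (p.compile d) .skip
  | .loop N p => .seq (.assign (3 + d) (.const 0))
      (.loop (.sub (.var N) (.var (3 + d)))
        (.seq (p.compile (d + 1)) (.assign (3 + d) (.add (.var (3 + d)) (.const 1)))))

/-- The effect of a program on the arrays. -/
def run (d : ℕ) (env : ℕ → ℕ) (M : Mem) : Prog → Mem
  | .store a i e => M.set a (i.eval ⟨env, M⟩) (e.eval ⟨env, M⟩)
  | .seq p q => q.run d env (p.run d env M)
  | .cond e p => if e.eval ⟨env, M⟩ ≠ 0 then p.run d env M else M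
  | .loop N p => Nat.rec M (fun j M' => p.run (d + 1) (Function.update env (3 + d) j) M') (env N)

/-- Loop bounds are input variables and expressions use only variables in scope. -/
def WF (d : ℕ) : Prog → Prop
  | .store _ i e => i.Below (3 + d) ∧ e.Below (3 + d)
  | .seq p q => p.WF d ∧ q.WF d
  | .cond e p => e.Below (3 + d) ∧ p.WF d
  | .loop N p => N < 3 ∧ p.WF (d + 1)

/-- An upper bound for the running time. -/
def cost (env : ℕ → ℕ) : Prog → ℕ
  | .store _ i e => i.cost + e.cost + 1
  | .seq p q => p.cost env + q.cost env
  | .cond e p => e.cost + 1 + (p.cost env + 1)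
  | .loop N p => 2 + (env N * (p.cost env + 8) + 4)

/-- The arrays that a program may write to. -/
def writes : Prog → List ℕ
  | .store a _ _ => [a]
  | .seq p q => p.writes ++ q.writes
  | .cond _ p => p.writes
  | .loop _ p => p.writes

/-- All loop bounds are variable `0` or variable `2`. -/
def BoundsOK : Prog → Prop
  | .store _ _ _ => True
  | .seq p q => p.BoundsOK ∧ q.BoundsOK
  | .cond _ p => p.BoundsOK
  | .loop N p => (N = 0 ∨ N = 2) ∧ p.BoundsOK

end Prog

theorem Expr.eval_congr {k : ℕ} {v w : ℕ → ℕ} (M : Mem) (h : ∀ x < k, v x = w x) :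
    ∀ e : Expr, e.Below k → e.eval ⟨v, M⟩ = e.eval ⟨w, M⟩
  | .const _, _ => rfl
  | .var x, hx => h x hx
  | .read a e, he => by simp only [Expr.eval]; rw [Expr.eval_congr M h e he]
  | .add e f, he => by
      simp only [Expr.eval]; rw [Expr.eval_congr M h e he.1, Expr.eval_congr M h f he.2]
  | .sub e f, he => by
      simp only [Expr.eval]; rw [Expr.eval_congr M h e he.1, Expr.eval_congr M h f he.2]

namespace Prog

theorem cost_congr {v w : ℕ → ℕ} (h : ∀ x < 3, v x = w x) :
    ∀ (p : Prog) (d : ℕ), p.WF d → p.cost v = p.cost w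
  | .store _ _ _, _, _ => rfl
  | .seq p q, d, hp => by
      simp only [cost]; rw [cost_congr h p d hp.1, cost_congr h q d hp.2]
  | .cond e p, d, hp => by simp only [cost]; rw [cost_congr h p d hp.2]
  | .loop N p, d, hp => by simp only [cost]; rw [cost_congr h p (d + 1) hp.2, h N hp.1]

/-- Induction on the number `k` of rounds still to be run, with the counter at `j`. Each round pays
4 for the test and 4 for the increment, and 4 more pay for the final failing test. The body enters
through the hypothesis `ih`, so that the lemma can be used inside the structural recursion of
`compile_runs`. -/
theorem compile_loop_runs {d N : ℕ} {p : Prog} {env : ℕ → ℕ} (hN : N < 3)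
    (ih : ∀ (e : ℕ → ℕ) (s : State), (∀ x < 3 + (d + 1), s.var x = e x) →
      (∀ x < 3, e x = env x) →
      ∃ s' t, Runs (p.compile (d + 1)) s s' t ∧ t ≤ p.cost env ∧
        s'.arr = p.run (d + 1) e s.arr ∧ ∀ x < 3 + (d + 1), s'.var x = s.var x) :
    ∀ (k j : ℕ) (s : State), j + k = env N → s.var (3 + d) = j →
      (∀ x < 3 + d, s.var x = env x) →
      ∀ M0 : Mem, s.arr = (Nat.rec M0
        (fun i M' => p.run (d + 1) (Function.update env (3 + d) i) M') j : Mem) →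
      ∃ s' t, Runs (.loop (.sub (.var N) (.var (3 + d)))
          (.seq (p.compile (d + 1)) (.assign (3 + d) (.add (.var (3 + d)) (.const 1))))) s s' t ∧
        t ≤ k * (p.cost env + 8) + 4 ∧
        s'.arr = (Nat.rec M0
          (fun i M' => p.run (d + 1) (Function.update env (3 + d) i) M') (env N) : Mem) ∧
        ∀ x < 3 + d, s'.var x = s.var x := by
  intro k
  induction k with
  | zero =>
    intro j s hj hs hv M0 hM
    refine ⟨s, 4, Runs.loop_false ?_, by omega, ?_, fun _ _ => rfl⟩
    · simp only [Expr.eval]; rw [hv N (by omega), hs]; omega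
    · rw [hM]; congr 1
  | succ k ihk =>
    intro j s hj hs hv M0 hM
    obtain ⟨s1, t1, hr, ht, ha, hx⟩ := ih (Function.update env (3 + d) j) s
      (by
        intro x hx
        by_cases h : x = 3 + d
        · subst h; simp [hs]
        · rw [Function.update_of_ne h]; exact hv x (by omega))
      (by intro x hx; rw [Function.update_of_ne (by omega)])
    obtain ⟨s2, t2, hr2, ht2, ha2, hx2⟩ := ihk (j + 1)
      ⟨Function.update s1.var (3 + d) (s1.var (3 + d) + 1), s1.arr⟩ (by omega)
      (by simp [hx (3 + d) (by omega), hs])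
      (by
        intro x hx'
        simp only
        rw [Function.update_of_ne (by omega), hx x (by omega), hv x hx'])
      M0 (by simp only; rw [ha, hM])
    refine ⟨s2, _, Runs.loop_true ?_ (Runs.seq hr (Runs.assign _ _ _)) hr2, ?_, ha2, ?_⟩
    · simp only [Expr.eval]; rw [hv N (by omega), hs]; omega
    · simp only [Expr.cost]
      have : (k + 1) * (p.cost env + 8) = k * (p.cost env + 8) + (p.cost env + 8) := by ring
      omega
    · intro x hx'
      rw [hx2 x hx']
      simp only
      rw [Function.update_of_ne (by omega), hx x (by omega)]

/-- The bridge from the functional semantics to the machine. It works because code at depth `d`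
assigns only variables from `3 + d` on, so loop bounds and outer counters survive. -/
theorem compile_runs : ∀ (p : Prog) (d : ℕ) (env : ℕ → ℕ) (s : State), p.WF d →
    (∀ x < 3 + d, s.var x = env x) →
    ∃ s' t, Runs (p.compile d) s s' t ∧ t ≤ p.cost env ∧ s'.arr = p.run d env s.arr ∧
      ∀ x < 3 + d, s'.var x = s.var x
  | .store a i e, d, env, s, hp, hs => by
      refine ⟨_, _, Runs.store a i e s, le_rfl, ?_, fun _ _ => rfl⟩
      simp only [run, Mem.set]
      rw [← Expr.eval_congr s.arr hs i hp.1, ← Expr.eval_congr s.arr hs e hp.2]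
  | .seq p q, d, env, s, hp, hs => by
      obtain ⟨s1, t1, h1, ht1, ha1, hv1⟩ := compile_runs p d env s hp.1 hs
      obtain ⟨s2, t2, h2, ht2, ha2, hv2⟩ := compile_runs q d env s1 hp.2
        (fun x hx => (hv1 x hx).trans (hs x hx))
      refine ⟨s2, t1 + t2, Runs.seq h1 h2, Nat.add_le_add ht1 ht2, ?_,
        fun x hx => (hv2 x hx).trans (hv1 x hx)⟩
      simp only [run]; rw [ha2, ha1]
  | .cond e p, d, env, s, hp, hs => by
      have he : e.eval s = e.eval ⟨env, s.arr⟩ := Expr.eval_congr s.arr hs e hp.1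
      by_cases h : e.eval s = 0
      · refine ⟨s, _, Runs.ite_false h (Runs.skip s), ?_, ?_, fun _ _ => rfl⟩
        · simp only [cost]; omega
        · simp [run, ← he, h]
      · obtain ⟨s1, t1, h1, ht1, ha1, hv1⟩ := compile_runs p d env s hp.2 hs
        refine ⟨s1, _, Runs.ite_true h h1, ?_, ?_, hv1⟩
        · simp only [cost]; omega
        · simp [run, ← he, h, ha1]
  | .loop N p, d, env, s, hp, hs => by
      obtain ⟨s', t, hr, ht, ha, hv⟩ := compile_loop_runs (d := d) (N := N) (p := p) (env := env)
        hp.1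
        (fun e s hse hee => by
          obtain ⟨s', t, h1, h2, h3, h4⟩ := compile_runs p (d + 1) e s hp.2 hse
          exact ⟨s', t, h1, by rwa [cost_congr hee p (d + 1) hp.2] at h2, h3, h4⟩)
        (env N) 0 ⟨Function.update s.var (3 + d) 0, s.arr⟩ (by omega) (by simp)
        (fun x hx => by simp only; rw [Function.update_of_ne (by omega), hs x hx]) s.arr rfl
      refine ⟨s', _, Runs.seq (Runs.assign _ _ _) hr, ?_, ha, ?_⟩
      · simp only [cost, Expr.cost]; omega
      · intro x hx
        rw [hv x hx]; simp only; rw [Function.update_of_ne (by omega)]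

/-- The nesting depth is fixed by the syntax, and each loop multiplies the cost by `n` or `2 * n` up
to constants. -/
theorem exists_cost_poly : ∀ p : Prog, p.BoundsOK →
    ∃ q : Polynomial ℕ, ∀ (v : ℕ → ℕ) (n : ℕ), v 0 = n → v 2 = 2 * n → p.cost v = q.eval n
  | .store _ i e, _ => ⟨Polynomial.C (i.cost + e.cost + 1), by simp [cost]⟩
  | .seq p q, h => by
      obtain ⟨a, ha⟩ := exists_cost_poly p h.1
      obtain ⟨b, hb⟩ := exists_cost_poly q h.2
      exact ⟨a + b, fun v n h0 h2 => by simp [cost, ha v n h0 h2, hb v n h0 h2]⟩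
  | .cond e p, h => by
      obtain ⟨a, ha⟩ := exists_cost_poly p h
      exact ⟨Polynomial.C (e.cost + 1) + (a + 1), fun v n h0 h2 => by
        simp [cost, ha v n h0 h2]⟩
  | .loop N p, h => by
      obtain ⟨a, ha⟩ := exists_cost_poly p h.2
      rcases h.1 with rfl | rfl
      · exact ⟨2 + (Polynomial.X * (a + 8) + 4), fun v n h0 h2 => by
          simp [cost, ha v n h0 h2, h0]⟩
      · exact ⟨2 + (2 * Polynomial.X * (a + 8) + 4), fun v n h0 h2 => by
          simp [cost, ha v n h0 h2, h2]⟩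

/-! ### Reasoning about programs -/

theorem run_loop {d N : ℕ} {env : ℕ → ℕ} {p : Prog} {M : Mem} (Inv : ℕ → Mem → Prop)
    (h0 : Inv 0 M)
    (step : ∀ j < env N, ∀ M', Inv j M' →
      Inv (j + 1) (p.run (d + 1) (Function.update env (3 + d) j) M')) :
    Inv (env N) ((Prog.loop N p).run d env M) := by
  have : ∀ k ≤ env N, Inv k (Nat.rec M
      (fun j M' => p.run (d + 1) (Function.update env (3 + d) j) M') k : Mem) := by
    intro k
    induction k with
    | zero => intro _; exact h0
    | succ k ih => intro hk; exact step k (by omega) _ (ih (by omega))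
  exact this _ le_rfl

theorem run_loop_inv {d N : ℕ} {env : ℕ → ℕ} {p : Prog} {M : Mem} (P : Mem → Prop)
    (h0 : P M)
    (step : ∀ j < env N, ∀ M', P M' → P (p.run (d + 1) (Function.update env (3 + d) j) M')) :
    P ((Prog.loop N p).run d env M) :=
  run_loop (fun _ => P) h0 step

/-- Every round `j` establishes `R j`, and the other rounds preserve it. -/
theorem run_loop_forall {d N : ℕ} {env : ℕ → ℕ} {p : Prog} {M : Mem} (P : Mem → Prop)
    (R : ℕ → Mem → Prop) (h0 : P M)
    (step : ∀ j < env N, ∀ M', P M' →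
      P (p.run (d + 1) (Function.update env (3 + d) j) M') ∧
      R j (p.run (d + 1) (Function.update env (3 + d) j) M') ∧
      ∀ i < env N, i ≠ j → R i M' → R i (p.run (d + 1) (Function.update env (3 + d) j) M')) :
    P ((Prog.loop N p).run d env M) ∧ ∀ j < env N, R j ((Prog.loop N p).run d env M) := by
  refine run_loop (fun k M' => P M' ∧ ∀ j < k, R j M') ⟨h0, by simp⟩ ?_ |>.imp id id
  rintro j hj M' ⟨hP, hR⟩
  obtain ⟨h1, h2, h3⟩ := step j hj M' hP
  refine ⟨h1, fun i hi => ?_⟩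
  rcases Nat.lt_succ_iff_lt_or_eq.mp hi with h | rfl
  · exact h3 i (h.trans hj) (by omega) (hR i h)
  · exact h2

theorem run_frame : ∀ (p : Prog) (d : ℕ) (env : ℕ → ℕ) (M : Mem) (a : ℕ), a ∉ p.writes →
    p.run d env M a = M a
  | .store b i e, d, env, M, a, h => by
      simp only [writes, List.mem_singleton] at h
      simp [run, Mem.set, h]
  | .seq p q, d, env, M, a, h => by
      simp only [writes, List.mem_append, not_or] at h
      simp only [run]
      rw [run_frame q _ _ _ _ h.2, run_frame p _ _ _ _ h.1]
  | .cond e p, d, env, M, a, h => by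
      simp only [run]
      split_ifs
      · exact run_frame p _ _ _ _ h
      · rfl
  | .loop N p, d, env, M, a, h =>
      run_loop_inv (fun M' => M' a = M a) rfl
        (fun j _ M' hM' => (run_frame p _ _ _ _ h).trans hM')

end Prog

@[simp] theorem Mem.set_same (M : Mem) (a k v : ℕ) : M.set a k v a k = v := by simp [Mem.set]

theorem Mem.set_apply (M : Mem) (a k v b l : ℕ) :
    M.set a k v b l = if b = a ∧ l = k then v else M b l := by
  unfold Mem.set
  by_cases hb : b = a
  · subst hb
    by_cases hl : l = k
    · subst hl; simp
    · simp [hl]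
  · simp [hb]

/-! ### Monophonic halfspaces and clique borders -/

section Graph

variable {V : Type*} {G : SimpleGraph V}

theorem mk_mem_edges_of_length_le_one {x y : V} (hxy : x ≠ y) :
    ∀ p : G.Walk x y, p.length ≤ 1 → s(x, y) ∈ p.edges
  | .nil, _ => absurd rfl hxy
  | .cons h .nil, _ => by simp
  | .cons h (.cons h' p), hl => by simp at hl

theorem length_eq_takeUntil_add_dropUntil [DecidableEq V] {u v x : V} (p : G.Walk u v)
    (hx : x ∈ p.support) : p.length = (p.takeUntil x hx).length + (p.dropUntil x hx).length := by
  rw [← SimpleGraph.Walk.length_append, p.take_spec hx]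

/-- A shortest walk inside `W` works: a repeated vertex could be bypassed, and a chord would be a
shortcut that stays in `W`. -/
theorem exists_chordless_path {W : Set V} {u v : V} (p : G.Walk u v)
    (hp : ∀ x ∈ p.support, x ∈ W) :
    ∃ q : G.Walk u v, q.IsPath ∧ q.IsChordless ∧ ∀ x ∈ q.support, x ∈ W := by
  classical
  have hex : ∃ k, ∃ q : G.Walk u v, (∀ x ∈ q.support, x ∈ W) ∧ q.length = k :=
    ⟨_, p, hp, rfl⟩
  obtain ⟨q, hqW, hql⟩ := Nat.find_spec hex
  have hmin : ∀ r : G.Walk u v, (∀ x ∈ r.support, x ∈ W) → q.length ≤ r.length := fun r hr =>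
    hql ▸ Nat.find_min' hex ⟨r, hr, rfl⟩
  refine ⟨q, ?_, ?_, hqW⟩
  · have := hmin q.bypass fun x hx => hqW x (q.support_bypass_subset_support hx)
    rw [← q.bypass_eq_self_of_length_le_length_bypass this]
    exact q.bypass_isPath
  · rw [SimpleGraph.Walk.isChordless_iff_forall_mem_edges]
    intro x y hx hy hxy
    have hdec : q = (q.takeUntil x hx).append (q.dropUntil x hx) := (q.take_spec hx).symm
    have hlen : q.length = (q.takeUntil x hx).length + (q.dropUntil x hx).length :=
      length_eq_takeUntil_add_dropUntil q hx
    have hy' := hy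
    rw [hdec, SimpleGraph.Walk.mem_support_append_iff] at hy'
    rcases hy' with hy' | hy'
    · set r := q.takeUntil x hx with hr
      have h2 : r.length = (r.takeUntil y hy').length + (r.dropUntil y hy').length :=
        length_eq_takeUntil_add_dropUntil r hy'
      have h3 := hmin ((r.takeUntil y hy').append
        (.cons hxy.symm (q.dropUntil x hx))) (by
          intro z hz
          apply hqW
          rw [SimpleGraph.Walk.mem_support_append_iff, SimpleGraph.Walk.support_cons] at hz
          rcases hz with hz | hz
          · exact q.support_takeUntil_subset_support hx
              (r.support_takeUntil_subset_support hy' hz)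
          · rcases List.mem_cons.mp hz with rfl | hz
            · exact hy
            · exact q.support_dropUntil_subset_support hx hz)
      simp only [SimpleGraph.Walk.length_append, SimpleGraph.Walk.length_cons] at h3
      have h4 := mk_mem_edges_of_length_le_one hxy.ne.symm (r.dropUntil y hy') (by omega)
      rw [Sym2.eq_swap]
      exact q.edges_takeUntil_subset_edges hx (r.edges_dropUntil_subset_edges hy' h4)
    · set r := q.dropUntil x hx with hr
      have h2 : r.length = (r.takeUntil y hy').length + (r.dropUntil y hy').length :=
        length_eq_takeUntil_add_dropUntil r hy'
      have h3 := hmin ((q.takeUntil x hx).append (.cons hxy (r.dropUntil y hy'))) (by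
          intro z hz
          apply hqW
          rw [SimpleGraph.Walk.mem_support_append_iff, SimpleGraph.Walk.support_cons] at hz
          rcases hz with hz | hz
          · exact q.support_takeUntil_subset_support hx hz
          · rcases List.mem_cons.mp hz with rfl | hz
            · exact hx
            · exact q.support_dropUntil_subset_support hx
                (r.support_dropUntil_subset_support hy' hz))
      simp only [SimpleGraph.Walk.length_append, SimpleGraph.Walk.length_cons] at h3
      have h4 := mk_mem_edges_of_length_le_one hxy.ne (r.takeUntil y hy') (by omega)
      exact q.edges_dropUntil_subset_edges hx (r.edges_takeUntil_subset_edges hy' h4)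

/-- The vertices of `H` with a neighbour outside `H` are pairwise adjacent. -/
def BorderClique (G : SimpleGraph V) (H : Set V) : Prop :=
  ∀ a b c d, G.Adj a b → G.Adj c d → a ∈ H → b ∉ H → c ∈ H → d ∉ H → a ≠ c → G.Adj a c

/-- If an induced path between points of `H` passes through `z` outside `H`, it crosses the border
once before and once after `z`. The two border vertices are adjacent, so inducedness makes their
edge part of the path. That edge lies in one of the two halves of the path, which forces one of its
endpoints to be `z`. -/
theorem BorderClique.mConvex {H : Set V} (hH : BorderClique G H) : MConvex G H := by
  classical
  rintro u hu v hv z ⟨-, w, hw, hind, hz⟩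
  rw [SimpleGraph.Walk.isInduced_toSubgraph] at hind
  by_contra hzH
  have hdec := w.take_spec hz
  obtain ⟨d, hd, hdH, hdH'⟩ := (w.takeUntil z hz).exists_boundary_dart H hu hzH
  obtain ⟨e, he, heH, heH'⟩ := (w.dropUntil z hz).exists_boundary_dart Hᶜ hzH (by simpa using hv)
  simp only [Set.mem_compl_iff, not_not] at heH heH'
  have hd1 : d.fst ∈ (w.takeUntil z hz).support :=
    SimpleGraph.Walk.dart_fst_mem_support_of_mem_darts _ hd
  have he1 : e.snd ∈ (w.dropUntil z hz).support :=
    SimpleGraph.Walk.dart_snd_mem_support_of_mem_darts _ he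
  have key : ∀ x, x ∈ (w.takeUntil z hz).support → x ∈ (w.dropUntil z hz).support → x = z := by
    intro x h1 h2
    by_contra hx
    have hnd : w.support.Nodup := hw.support_nodup
    rw [← hdec, SimpleGraph.Walk.support_append] at hnd
    refine List.disjoint_of_nodup_append hnd h1 ?_
    rw [← SimpleGraph.Walk.cons_tail_support] at h2
    exact (List.mem_cons.mp h2).resolve_left hx
  have hne : d.fst ≠ e.snd := by
    intro h
    have := key d.fst hd1 (h ▸ he1)
    exact hzH (this ▸ hdH)
  have hadj := hH d.fst d.snd e.snd e.fst d.adj e.adj.symm hdH hdH' heH' heH hne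
  have hedge := hind.mem_edges (w.support_takeUntil_subset_support hz hd1)
    (w.support_dropUntil_subset_support hz he1) hadj
  rw [← hdec, SimpleGraph.Walk.edges_append, List.mem_append] at hedge
  rcases hedge with h | h
  · exact hzH (key e.snd (SimpleGraph.Walk.snd_mem_support_of_mem_edges _ h) he1 ▸ heH')
  · exact hzH (key d.fst hd1 (SimpleGraph.Walk.fst_mem_support_of_mem_edges _ h) ▸ hdH)

theorem exists_chordless_path_of_connected (hG : G.Connected) (u v : V) :
    ∃ q : G.Walk u v, q.IsPath ∧ q.IsChordless := by
  obtain ⟨p⟩ := hG u v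
  obtain ⟨q, h1, h2, -⟩ := exists_chordless_path (W := Set.univ) p (by simp)
  exact ⟨q, h1, h2⟩

theorem mem_mInterval {u v z : V} (huv : u ≠ v) {q : G.Walk u v} (hq : q.IsPath)
    (hq' : q.IsChordless) (hz : z ∈ q.support) : z ∈ mInterval G u v :=
  ⟨huv, q, hq, SimpleGraph.Walk.isInduced_toSubgraph.mpr hq', hz⟩

/-- Convexity of the complement joins `b` to `d` outside `H`, so there is a walk from `a` to `c`
whose inner vertices avoid `H`. Make it chordless within those vertices. The vertex after `a` lies
in `H` by convexity, so it must be `c`, and `a` and `c` are adjacent after all. -/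
theorem borderClique_of_mHalfspace (hG : G.Connected) {H : Set V} (hH : H ∈ mHalfspaces G) :
    BorderClique G H := by
  classical
  intro a b c d hab hcd ha hb hc hd hac
  by_contra hnadj
  obtain ⟨p, hp⟩ : ∃ p : G.Walk b d, ∀ x ∈ p.support, x ∈ Hᶜ := by
    obtain ⟨q, h1, h2⟩ := exists_chordless_path_of_connected hG b d
    by_cases hbd : b = d
    · subst hbd
      exact ⟨.nil, by simpa using hb⟩
    · exact ⟨q, fun x hx => hH.2 b hb d hd (mem_mInterval hbd h1 h2 hx)⟩
  obtain ⟨q, hq1, hq2, hqW⟩ := exists_chordless_path (W := {x | x ∈ Hᶜ ∨ x = a ∨ x = c})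
    (.cons hab (p.append (.cons hcd.symm .nil))) (by
      intro x hx
      simp only [SimpleGraph.Walk.support_cons, List.mem_cons,
        SimpleGraph.Walk.mem_support_append_iff, SimpleGraph.Walk.support_nil,
        List.not_mem_nil, or_false] at hx
      rcases hx with rfl | hx | rfl | rfl
      · simp
      · exact Or.inl (hp x hx)
      · exact Or.inl hd
      · simp)
  cases q with
  | nil => exact hac rfl
  | @cons _ y _ hay q' =>
    have hy : y ∈ H := hH.1 a ha c hc (mem_mInterval hac hq1 hq2 (by simp))
    rcases hqW y (by simp) with h | rfl | rfl
    · exact h hy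
    · exact hay.ne rfl
    · exact hnadj hay

theorem compl_mem_mHalfspaces {H : Set V} (hH : H ∈ mHalfspaces G) : Hᶜ ∈ mHalfspaces G :=
  ⟨hH.2, by simpa using hH.1⟩

theorem mem_mHalfspaces_iff (hG : G.Connected) {H : Set V} :
    H ∈ mHalfspaces G ↔ BorderClique G H ∧ BorderClique G Hᶜ :=
  ⟨fun h => ⟨borderClique_of_mHalfspace hG h,
    borderClique_of_mHalfspace hG (compl_mem_mHalfspaces h)⟩,
    fun h => ⟨h.1.mConvex, h.2.mConvex⟩⟩

/-- A family of vertices all of whose dichotomies are realized by halfspaces has at most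
`2 ω(G) + 1` members. -/
theorem card_le_of_shattered [Finite V] (hG : G.Connected) {ι : Type*} {s : Finset ι} {x : ι → V}
    (hs : ∀ J : Set ι, ∃ H ∈ mHalfspaces G, ∀ i ∈ s, x i ∈ H ↔ i ∈ J) :
    s.card ≤ 2 * G.cliqueNum + 1 := by
  classical
  by_contra hcard
  set k := G.cliqueNum + 1 with hk
  obtain ⟨e, he⟩ : ∃ e : Fin k × Bool → ι, Function.Injective e ∧ ∀ i, e i ∈ s := by
    have : Fintype.card (Fin k × Bool) ≤ Fintype.card s := by
      simp [hk]; omega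
    obtain ⟨f⟩ := Function.Embedding.nonempty_of_card_le this
    exact ⟨fun i => (f i).1, fun i j h => f.injective (Subtype.ext h), fun i => (f i).2⟩
  -- This halfspace separates all pairs simultaneously. Each pair then yields a border vertex `u j`
  -- on a chordless path between its members.
  obtain ⟨H, hH, hHx⟩ := hs {i | ∃ j, i = e (j, true)}
  have ha : ∀ j, x (e (j, true)) ∈ H := fun j => (hHx _ (he.2 _)).mpr ⟨j, rfl⟩
  have hb : ∀ j, x (e (j, false)) ∉ H := by
    intro j hj
    obtain ⟨i, hi⟩ := (hHx _ (he.2 _)).mp hj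
    simpa using he.1 hi
  have hex : ∀ j, ∃ u w, G.Adj u w ∧ u ∈ H ∧ w ∉ H ∧
      u ∈ mInterval G (x (e (j, true))) (x (e (j, false))) := by
    intro j
    obtain ⟨q, hq1, hq2⟩ := exists_chordless_path_of_connected hG
      (x (e (j, true))) (x (e (j, false)))
    obtain ⟨d, hd, hd1, hd2⟩ := q.exists_boundary_dart H (ha j) (hb j)
    refine ⟨d.fst, d.snd, d.adj, hd1, hd2, mem_mInterval ?_ hq1 hq2
      (SimpleGraph.Walk.dart_fst_mem_support_of_mem_darts _ hd)⟩
    intro h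
    exact hb j (h ▸ ha j)
  choose u w huw huH hwH huI using hex
  -- A second dichotomy, with pair `i` inside and pair `j` outside, puts the intervals of the two
  -- pairs on opposite sides, so they share no vertex.
  have hinj : Function.Injective u := by
    intro i j hij
    by_contra hne
    obtain ⟨K, hK, hKx⟩ := hs {l | ∃ t, l = e (i, t)}
    have h1 : u i ∈ K := hK.1 _ ((hKx _ (he.2 _)).mpr ⟨_, rfl⟩) _
      ((hKx _ (he.2 _)).mpr ⟨_, rfl⟩) (huI i)
    have hnot : ∀ t, x (e (j, t)) ∉ K := by
      intro t ht
      obtain ⟨t', ht'⟩ := (hKx _ (he.2 _)).mp ht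
      have := he.1 ht'
      simp only [Prod.mk.injEq] at this
      exact hne this.1.symm
    exact hK.2 _ (hnot true) _ (hnot false) (huI j) (hij ▸ h1)
  have hcl : G.IsClique (Finset.univ.image u : Finset V) := by
    intro a ha' b hb' hab
    simp only [Finset.coe_image, Finset.coe_univ, Set.image_univ, Set.mem_range] at ha' hb'
    obtain ⟨i, rfl⟩ := ha'
    obtain ⟨j, rfl⟩ := hb'
    exact borderClique_of_mHalfspace hG hH _ _ _ _ (huw i) (huw j) (huH i) (hwH i) (huH j)
      (hwH j) hab
  have := SimpleGraph.IsClique.card_le_cliqueNum (tc := hcl)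
  rw [Finset.card_image_of_injective _ hinj] at this
  simp [hk] at this

theorem one_le_cliqueNum [Finite V] [Nonempty V] : 1 ≤ G.cliqueNum := by
  obtain ⟨v⟩ := ‹Nonempty V›
  have h : G.IsClique (({v} : Finset V) : Set V) := by simp
  simpa using SimpleGraph.IsClique.card_le_cliqueNum (tc := h)

end Graph

/-! ### Uniform convergence by the double sample -/

section Sampling

open Classical in
/-- The number of sample points in `E`. -/
def hits {m : ℕ} {X : Type*} (E : Set X) (T : Fin m → X) : ℕ :=
  (Finset.univ.filter fun i => T i ∈ E).card

variable {X : Type*} [Fintype X] {w : X → ℝ} {m : ℕ}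

-- Exponential moments: the indicator of few hits is at most `2 ^ (κ - hits)`, whose expectation
-- factors over the coordinates. Each factor is one minus half the weight of `E`.
open Classical in
theorem sum_few_hits_le (hw : ∀ x, 0 ≤ w x) (hw1 : ∑ x, w x = 1) {E : Set X} {ε : ℝ}
    (hE : ε < ∑ x, if x ∈ E then w x else 0) (κ : ℝ) :
    ∑ T : Fin m → X, (if (hits E T : ℝ) < κ then ∏ i, w (T i) else 0) ≤
      2 ^ κ * (1 - ε / 2) ^ m := by
  have h1 : ∀ T : Fin m → X, (if (hits E T : ℝ) < κ then ∏ i, w (T i) else 0) ≤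
      2 ^ κ * ∏ i, (w (T i) * if T i ∈ E then (1 / 2 : ℝ) else 1) := by
    intro T
    have hpos : 0 ≤ ∏ i, w (T i) := Finset.prod_nonneg fun i _ => hw _
    have hprod : ∏ i, (if T i ∈ E then (1 / 2 : ℝ) else 1) = 2 ^ (-(hits E T : ℝ)) := by
      rw [Finset.prod_ite]
      simp only [Finset.prod_const, one_pow, mul_one, hits]
      rw [Real.rpow_neg (by norm_num), Real.rpow_natCast]
      simp
    rw [Finset.prod_mul_distrib, hprod]
    have h2 : (2 : ℝ) ^ κ * ((∏ i, w (T i)) * 2 ^ (-(hits E T : ℝ))) =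
        2 ^ (κ - hits E T) * ∏ i, w (T i) := by
      rw [sub_eq_add_neg, Real.rpow_add (by norm_num)]; ring
    rw [h2]
    split_ifs with h
    · exact le_mul_of_one_le_left hpos (Real.one_le_rpow (by norm_num) (by linarith))
    · positivity
  refine (Finset.sum_le_sum fun T _ => h1 T).trans ?_
  rw [← Finset.mul_sum, ← Fintype.sum_pow (fun x => w x * if x ∈ E then (1 / 2 : ℝ) else 1) m]
  refine mul_le_mul_of_nonneg_left (pow_le_pow_left₀ ?_ ?_ m) (by positivity)
  · exact Finset.sum_nonneg fun x _ => mul_nonneg (hw x) (by split_ifs <;> norm_num)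
  · have h3 : ∀ x, (w x * if x ∈ E then (1 / 2 : ℝ) else 1) =
        w x - (if x ∈ E then w x else 0) / 2 := by
      intro x; split_ifs <;> ring
    simp only [h3, Finset.sum_sub_distrib, hw1, ← Finset.sum_div]
    linarith

theorem two_rpow_mul_le_half {ε : ℝ} (hε1 : ε ≤ 1) (hm : 4 ≤ ε * m) :
    (2 : ℝ) ^ (ε * m / 4) * (1 - ε / 2) ^ m ≤ 1 / 2 := by
  have hl : Real.log 2 < 0.6931471808 := Real.log_two_lt_d9
  have h1 : (1 - ε / 2) ^ m ≤ Real.exp (-(ε * m / 2)) := by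
    have : 1 - ε / 2 ≤ Real.exp (-(ε / 2)) := by
      have := Real.add_one_le_exp (-(ε / 2)); linarith
    refine (pow_le_pow_left₀ (by linarith) this m).trans (le_of_eq ?_)
    rw [← Real.exp_nat_mul]; congr 1; ring
  have h2 : (2 : ℝ) ^ (ε * m / 4) = Real.exp (Real.log 2 * (ε * m / 4)) :=
    Real.rpow_def_of_pos (by norm_num) _
  have h3 : (1 / 2 : ℝ) = Real.exp (-Real.log 2) := by
    rw [Real.exp_neg, Real.exp_log (by norm_num)]; norm_num
  rw [h2, h3]
  refine (mul_le_mul_of_nonneg_left h1 (Real.exp_nonneg _)).trans ?_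
  rw [← Real.exp_add, Real.exp_le_exp]
  nlinarith

/-- Splitting a double sample into its halves. -/
def splitEquiv (m : ℕ) (X : Type*) : (Fin m × Bool → X) ≃ (Fin m → X) × (Fin m → X) where
  toFun Z := (fun i => Z (i, false), fun i => Z (i, true))
  invFun P := fun q => if q.2 then P.2 q.1 else P.1 q.1
  left_inv Z := by
    ext ⟨i, b⟩
    cases b <;> simp
  right_inv P := by simp

/-- Swapping the two halves of a double sample at the positions given by `σ`. -/
def swapEquiv {m : ℕ} (σ : Fin m → Bool) : Fin m × Bool ≃ Fin m × Bool where
  toFun q := (q.1, xor q.2 (σ q.1))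
  invFun q := (q.1, xor q.2 (σ q.1))
  left_inv q := by simp
  right_inv q := by simp

/-- Some member of the family misses the first half of `Z` and hits the second at least `κ`
times. -/
def DoubleBad (𝓔 : Set (Set X)) (κ : ℝ) (Z : Fin m × Bool → X) : Prop :=
  ∃ E ∈ 𝓔, (∀ i, Z (i, false) ∉ E) ∧ κ ≤ hits E fun i => Z (i, true)

-- Symmetrization: given a first half with a heavy but missed set `E`, an independent second half
-- hits `E` at least `ε * m / 4` times with probability at least one half.
open Classical in
theorem sum_bad_le_double (hw : ∀ x, 0 ≤ w x) (hw1 : ∑ x, w x = 1) (𝓔 : Set (Set X)) {ε : ℝ}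
    (hε1 : ε ≤ 1) (hm : 4 ≤ ε * m) :
    ∑ S : Fin m → X, (if ∃ E ∈ 𝓔, (ε < ∑ x, if x ∈ E then w x else 0) ∧ ∀ i, S i ∉ E
        then ∏ i, w (S i) else 0) ≤
      2 * ∑ Z : Fin m × Bool → X, (if DoubleBad 𝓔 (ε * m / 4) Z then ∏ q, w (Z q) else 0) := by
  have htot : ∑ T : Fin m → X, ∏ i, w (T i) = 1 := by
    rw [← Fintype.sum_pow, hw1, one_pow]
  have hpr : ∀ T : Fin m → X, 0 ≤ ∏ i, w (T i) := fun T => Finset.prod_nonneg fun i _ => hw _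
  have hsplit : ∑ Z : Fin m × Bool → X,
        (if DoubleBad 𝓔 (ε * m / 4) Z then ∏ q, w (Z q) else 0) =
      ∑ S : Fin m → X, ∑ T : Fin m → X,
        (if ∃ E ∈ 𝓔, (∀ i, S i ∉ E) ∧ ε * m / 4 ≤ hits E T
          then (∏ i, w (S i)) * ∏ i, w (T i) else 0) := by
    rw [← Fintype.sum_prod_type', ← (splitEquiv m X).sum_comp]
    refine Finset.sum_congr rfl fun Z _ => ?_
    have : ∏ q, w (Z q) = (∏ i, w (Z (i, false))) * ∏ i, w (Z (i, true)) := by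
      rw [Fintype.prod_prod_type]
      simp [Finset.prod_mul_distrib, mul_comm]
    rw [this]
    refine if_congr Iff.rfl rfl rfl
  rw [hsplit, Finset.mul_sum]
  refine Finset.sum_le_sum fun S _ => ?_
  split_ifs with h
  · obtain ⟨E, hE, hEε, hES⟩ := h
    have h1 := (sum_few_hits_le (m := m) hw hw1 hEε (ε * m / 4)).trans
      (two_rpow_mul_le_half hε1 hm)
    have h2 : (1 / 2 : ℝ) ≤ ∑ T : Fin m → X,
        (if ε * m / 4 ≤ (hits E T : ℝ) then ∏ i, w (T i) else 0) := by
      have : ∑ T : Fin m → X, (if (hits E T : ℝ) < ε * m / 4 then ∏ i, w (T i) else 0) +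
          ∑ T : Fin m → X, (if ε * m / 4 ≤ (hits E T : ℝ) then ∏ i, w (T i) else 0) = 1 := by
        rw [← htot, ← Finset.sum_add_distrib]
        refine Finset.sum_congr rfl fun T _ => ?_
        by_cases h : (hits E T : ℝ) < ε * m / 4
        · simp [h, not_le.mpr h]
        · simp [h, not_lt.mp h]
      linarith
    have h3 : (∏ i, w (S i)) * ∑ T : Fin m → X,
        (if ε * m / 4 ≤ (hits E T : ℝ) then ∏ i, w (T i) else 0) ≤ ∑ T : Fin m → X,
        (if ∃ E ∈ 𝓔, (∀ i, S i ∉ E) ∧ ε * m / 4 ≤ hits E T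
          then (∏ i, w (S i)) * ∏ i, w (T i) else 0) := by
      rw [Finset.mul_sum]
      refine Finset.sum_le_sum fun T _ => ?_
      by_cases h : ε * m / 4 ≤ (hits E T : ℝ)
      · rw [if_pos h, if_pos ⟨E, hE, hES, h⟩]
      · rw [if_neg h, mul_zero]
        split_ifs
        · exact mul_nonneg (hpr S) (hpr T)
        · rfl
    nlinarith [hpr S]
  · refine mul_nonneg (by norm_num) (Finset.sum_nonneg fun T _ => ?_)
    split_ifs
    · exact mul_nonneg (hpr S) (hpr T)
    · rfl

open Classical in
/-- Swaps that put all of at least `κ` hits into the second half are rare. -/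
theorem card_swaps_le (A : Finset (Fin m × Bool)) (κ : ℝ) :
    ((Finset.univ.filter fun σ : Fin m → Bool => (∀ i, (i, σ i) ∉ A) ∧
      κ ≤ (Finset.univ.filter fun i => (i, !σ i) ∈ A).card).card : ℝ) ≤ 2 ^ m * 2 ^ (-κ) := by
  set F := Finset.univ.filter fun σ : Fin m → Bool => (∀ i, (i, σ i) ∉ A) ∧
      κ ≤ (Finset.univ.filter fun i => (i, !σ i) ∈ A).card with hF
  rcases F.eq_empty_or_nonempty with h | ⟨σ₀, hσ₀⟩
  · rw [h]; simp; positivity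
  · rw [hF, Finset.mem_filter] at hσ₀
    obtain ⟨-, h1, h2⟩ := hσ₀
    -- Every admissible swap must agree with `σ₀` on `I`, since otherwise its first half would meet
    -- `A`. Only the positions outside `I` are free, and `I` has at least `κ` elements.
    set I := Finset.univ.filter fun i => (i, !σ₀ i) ∈ A with hI
    have hsub : F ⊆ Fintype.piFinset fun i => if i ∈ I then {σ₀ i} else Finset.univ := by
      intro σ hσ
      rw [hF, Finset.mem_filter] at hσ
      rw [Fintype.mem_piFinset]
      intro i
      split_ifs with hi
      · rw [Finset.mem_singleton]
        by_contra hne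
        have : σ i = !σ₀ i := by
          cases h : σ i <;> cases h' : σ₀ i <;> simp_all
        rw [hI, Finset.mem_filter] at hi
        exact hσ.2.1 i (this ▸ hi.2)
      · exact Finset.mem_univ _
    have hcard : (Fintype.piFinset fun i => if i ∈ I then {σ₀ i} else Finset.univ).card =
        2 ^ (m - I.card) := by
      rw [Fintype.card_piFinset]
      have : ∀ i, (if i ∈ I then ({σ₀ i} : Finset Bool) else Finset.univ).card =
          if i ∈ I then 1 else 2 := by
        intro i; split_ifs <;> simp
      simp only [this]
      rw [Finset.prod_ite]
      simp only [Finset.prod_const, one_pow, one_mul]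
      congr 1
      rw [← Finset.compl_filter, Finset.card_compl]
      simp
    have hle := Finset.card_le_card hsub
    rw [hcard] at hle
    have hIm : I.card ≤ m := by simpa using I.card_le_univ
    calc (F.card : ℝ) ≤ 2 ^ (m - I.card) := by exact_mod_cast hle
      _ = 2 ^ m * (2 : ℝ) ^ (-(I.card : ℝ)) := by
        rw [Real.rpow_neg (by norm_num), Real.rpow_natCast, pow_sub₀ _ (by norm_num) hIm]
      _ ≤ 2 ^ m * 2 ^ (-κ) := by
        refine mul_le_mul_of_nonneg_left ?_ (by positivity)
        exact Real.rpow_le_rpow_of_exponent_le (by norm_num) (by linarith)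

/-- A quantitative form of the Sauer–Shelah lemma. -/
theorem card_family_le {ι : Type*} [Fintype ι] [DecidableEq ι] (𝒜 : Finset (Finset ι)) {d : ℕ}
    (hd : ∀ s, 𝒜.Shatters s → s.card ≤ d) {x : ℝ} (hx : 0 < x) (hx1 : x ≤ 1) :
    (𝒜.card : ℝ) ≤ (1 / x) ^ d * (1 + x) ^ Fintype.card ι := by
  have h1 : (𝒜.card : ℝ) ≤ 𝒜.shatterer.card := by exact_mod_cast 𝒜.card_le_card_shatterer
  have h2 : (𝒜.shatterer.card : ℝ) ≤ ∑ s ∈ 𝒜.shatterer, (1 / x) ^ d * x ^ s.card := by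
    -- Since shattered sets have size at most `d`, each 1 is bounded by `x ^ (|s| - d)`. Extending
    -- the sum of `x ^ |s|` to all subsets gives the binomial expansion of `(1 + x) ^ |ι|`.
    rw [Finset.card_eq_sum_ones, Nat.cast_sum]
    refine Finset.sum_le_sum fun s hs => ?_
    have hsd := hd s (Finset.mem_shatterer.mp hs)
    have : x ^ d ≤ x ^ s.card := pow_le_pow_of_le_one hx.le hx1 hsd
    rw [one_div, inv_pow, Nat.cast_one, inv_mul_eq_div, le_div_iff₀ (by positivity)]
    linarith
  have h3 : ∑ s ∈ 𝒜.shatterer, (1 / x) ^ d * x ^ s.card ≤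
      ∑ s ∈ (Finset.univ : Finset ι).powerset, (1 / x) ^ d * x ^ s.card :=
    Finset.sum_le_sum_of_subset_of_nonneg (fun s _ => by simp) fun s _ _ => by positivity
  have h4 : ∑ s ∈ (Finset.univ : Finset ι).powerset, x ^ s.card = (1 + x) ^ Fintype.card ι := by
    have := Finset.sum_pow_mul_eq_add_pow x 1 (Finset.univ : Finset ι)
    simpa [add_comm] using this
  simp only [← Finset.mul_sum] at h2 h3
  rw [h4] at h3
  linarith

-- Union bound over the traces of `𝓔` on the double sample. Traces are taken on indices rather than
-- points, so repeated sample points need no special treatment.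
open Classical in
theorem card_doubleBad_swaps_le {𝓔 : Set (Set X)} {d : ℕ} {x : ℝ} (hx : 0 < x) (hx1 : x ≤ 1)
    (κ : ℝ) (Z : Fin m × Bool → X)
    (hd : ∀ s : Finset (Fin m × Bool),
      (∀ J : Set (Fin m × Bool), ∃ E ∈ 𝓔, ∀ i ∈ s, Z i ∈ E ↔ i ∈ J) → s.card ≤ d) :
    ((Finset.univ.filter fun σ : Fin m → Bool =>
        DoubleBad 𝓔 κ (Z ∘ swapEquiv σ)).card : ℝ) ≤
      ((1 / x) ^ d * (1 + x) ^ (2 * m)) * (2 ^ m * 2 ^ (-κ)) := by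
  set 𝒜 : Finset (Finset (Fin m × Bool)) :=
    Finset.univ.filter fun A => ∃ E ∈ 𝓔, ∀ q, q ∈ A ↔ Z q ∈ E with h𝒜
  have hcard : (𝒜.card : ℝ) ≤ (1 / x) ^ d * (1 + x) ^ (2 * m) := by
    have := card_family_le 𝒜 (d := d) (x := x) ?_ hx hx1
    · rwa [Fintype.card_prod, Fintype.card_fin, Fintype.card_bool, mul_comm m 2] at this
    · intro s hs
      refine hd s fun J => ?_
      obtain ⟨A, hA, hsA⟩ := hs (t := s.filter (· ∈ J)) (Finset.filter_subset _ _)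
      rw [h𝒜, Finset.mem_filter] at hA
      obtain ⟨-, E, hE, hAE⟩ := hA
      refine ⟨E, hE, fun i hi => ?_⟩
      rw [← hAE]
      have := congrArg (i ∈ ·) hsA
      simpa [hi] using this
  have hsub : (Finset.univ.filter fun σ : Fin m → Bool => DoubleBad 𝓔 κ (Z ∘ swapEquiv σ)) ⊆
      𝒜.biUnion fun A => Finset.univ.filter fun σ : Fin m → Bool => (∀ i, (i, σ i) ∉ A) ∧
        κ ≤ (Finset.univ.filter fun i => (i, !σ i) ∈ A).card := by
    intro σ hσ
    obtain ⟨E, hE, h1, h2⟩ := (Finset.mem_filter.mp hσ).2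
    rw [Finset.mem_biUnion]
    refine ⟨Finset.univ.filter fun q => Z q ∈ E, ?_, ?_⟩
    · simp only [h𝒜, Finset.mem_filter, Finset.mem_univ, true_and]
      exact ⟨E, hE, fun q => by simp⟩
    · simp only [Finset.mem_filter, Finset.mem_univ, true_and]
      refine ⟨fun i => ?_, ?_⟩
      · simpa [swapEquiv] using h1 i
      · simpa [swapEquiv, hits] using h2
  calc _ ≤ ((𝒜.biUnion fun A => Finset.univ.filter fun σ : Fin m → Bool =>
        (∀ i, (i, σ i) ∉ A) ∧
        κ ≤ (Finset.univ.filter fun i => (i, !σ i) ∈ A).card).card : ℝ) := by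
        exact_mod_cast Finset.card_le_card hsub
    _ ≤ ∑ A ∈ 𝒜, ((Finset.univ.filter fun σ : Fin m → Bool => (∀ i, (i, σ i) ∉ A) ∧
        κ ≤ (Finset.univ.filter fun i => (i, !σ i) ∈ A).card).card : ℝ) := by
        exact_mod_cast Finset.card_biUnion_le
    _ ≤ ∑ A ∈ 𝒜, (2 ^ m * 2 ^ (-κ) : ℝ) := Finset.sum_le_sum fun A _ => card_swaps_le A κ
    _ = 𝒜.card * (2 ^ m * 2 ^ (-κ) : ℝ) := by simp
    _ ≤ _ := mul_le_mul_of_nonneg_right hcard (by positivity)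

-- The product weight is invariant under each swap, so the sum can be averaged over all `2 ^ m`
-- swaps, and the previous count applies to every fixed `Z`.
open Classical in
theorem sum_doubleBad_le (hw : ∀ x, 0 ≤ w x) (hw1 : ∑ x, w x = 1) {𝓔 : Set (Set X)} {d : ℕ}
    {x : ℝ} (hx : 0 < x) (hx1 : x ≤ 1) (κ : ℝ)
    (hd : ∀ (Z : Fin m × Bool → X) (s : Finset (Fin m × Bool)),
      (∀ J : Set (Fin m × Bool), ∃ E ∈ 𝓔, ∀ i ∈ s, Z i ∈ E ↔ i ∈ J) → s.card ≤ d) :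
    ∑ Z : Fin m × Bool → X, (if DoubleBad 𝓔 κ Z then ∏ q, w (Z q) else 0) ≤
      ((1 / x) ^ d * (1 + x) ^ (2 * m)) * 2 ^ (-κ) := by
  have hswap : ∀ σ : Fin m → Bool,
      ∑ Z : Fin m × Bool → X, (if DoubleBad 𝓔 κ Z then ∏ q, w (Z q) else 0) =
      ∑ Z : Fin m × Bool → X, (if DoubleBad 𝓔 κ (Z ∘ swapEquiv σ) then ∏ q, w (Z q) else 0) := by
    intro σ
    rw [← ((swapEquiv σ).arrowCongr (Equiv.refl X)).sum_comp]
    refine Finset.sum_congr rfl fun Z _ => ?_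
    have h1 : ((swapEquiv σ).arrowCongr (Equiv.refl X)) Z = Z ∘ swapEquiv σ := rfl
    rw [h1]
    congr 1
    exact (swapEquiv σ).prod_comp fun q => w (Z q)
  have htot : ∑ Z : Fin m × Bool → X, ∏ q, w (Z q) = 1 := by
    rw [← Fintype.prod_sum (fun _ x => w x)]
    simp [hw1]
  have h2 : (2 : ℝ) ^ m * ∑ Z : Fin m × Bool → X,
      (if DoubleBad 𝓔 κ Z then ∏ q, w (Z q) else 0) =
      ∑ Z : Fin m × Bool → X, (∏ q, w (Z q)) *
        ((Finset.univ.filter fun σ : Fin m → Bool => DoubleBad 𝓔 κ (Z ∘ swapEquiv σ)).card : ℝ) := by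
    have : (2 : ℝ) ^ m * ∑ Z : Fin m × Bool → X,
        (if DoubleBad 𝓔 κ Z then ∏ q, w (Z q) else 0) =
        ∑ σ : Fin m → Bool, ∑ Z : Fin m × Bool → X,
          (if DoubleBad 𝓔 κ (Z ∘ swapEquiv σ) then ∏ q, w (Z q) else 0) := by
      rw [← Finset.sum_congr rfl fun σ _ => hswap σ]
      simp
    rw [this, Finset.sum_comm]
    refine Finset.sum_congr rfl fun Z _ => ?_
    rw [← Finset.sum_filter, Finset.sum_const, nsmul_eq_mul, mul_comm]
  have h3 : ∑ Z : Fin m × Bool → X, (∏ q, w (Z q)) *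
        ((Finset.univ.filter fun σ : Fin m → Bool => DoubleBad 𝓔 κ (Z ∘ swapEquiv σ)).card : ℝ) ≤
      ∑ Z : Fin m × Bool → X, (∏ q, w (Z q)) *
        (((1 / x) ^ d * (1 + x) ^ (2 * m)) * (2 ^ m * 2 ^ (-κ))) :=
    Finset.sum_le_sum fun Z _ => mul_le_mul_of_nonneg_left
      (card_doubleBad_swaps_le hx hx1 κ Z (hd Z)) (Finset.prod_nonneg fun q _ => hw _)
  rw [← Finset.sum_mul, htot, one_mul, ← h2] at h3
  have h4 : (0 : ℝ) < 2 ^ m := by positivity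
  refine le_of_mul_le_mul_left (h3.trans (le_of_eq ?_)) h4
  ring

/-- With `x = ε / 32` the growth factor `(1 + x) ^ (2 * m)` is at most `exp (ε * m / 16)`, while the
swaps gain `exp (log 2 * ε * m / 4)`. The net rate exceeds `0.11 * ε * m`, so the constant 200 gives
at least `22 * (ω * L + log (1 / δ))`. This covers `15 * ω * L` from the shattering bound, `log 2 ≤
ω * L`, and `log (1 / δ)`. -/
theorem sample_bound_le {ε δ L : ℝ} {d ω : ℕ} (hε : 0 < ε) (hε1 : ε < 1) (hδ : 0 < δ) (hδ1 : δ < 1)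
    (hω : 1 ≤ ω) (hd : d ≤ 3 * ω) (hL : L = Real.log (2 / ε))
    (hm : 200 * ((ω * L + Real.log (1 / δ)) / ε) ≤ m) :
    2 * (((1 / (ε / 32)) ^ d * (1 + ε / 32) ^ (2 * m)) * 2 ^ (-(ε * m / 4))) ≤ δ := by
  have hl1 : 0.6931471803 < Real.log 2 := Real.log_two_gt_d9
  have hm' : 200 * (ω * L + Real.log (1 / δ)) ≤ ε * m := by
    rw [← mul_div_assoc, div_le_iff₀ hε] at hm; linarith
  have hL2 : Real.log 2 ≤ L := by
    rw [hL]; exact Real.log_le_log (by norm_num) (by rw [le_div_iff₀ hε]; linarith)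
  have hLε : L = Real.log 2 - Real.log ε := by
    rw [hL, Real.log_div (by norm_num) hε.ne']
  have hlogε : Real.log ε < 0 := Real.log_neg hε hε1
  have hd' : (d : ℝ) ≤ 3 * ω := by exact_mod_cast hd
  have hω' : (1 : ℝ) ≤ ω := by exact_mod_cast hω
  have e1 : (1 / (ε / 32)) ^ d ≤ Real.exp (3 * ω * (5 * L)) := by
    have h1 : Real.log (1 / (ε / 32)) ≤ 5 * L := by
      have : Real.log 32 = 5 * Real.log 2 := by
        rw [show (32 : ℝ) = 2 ^ 5 by norm_num, Real.log_pow]; norm_num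
      rw [one_div, Real.log_inv, Real.log_div hε.ne' (by norm_num), this]
      linarith
    have h0 : 0 ≤ Real.log (1 / (ε / 32)) :=
      Real.log_nonneg (by rw [le_div_iff₀ (by positivity)]; linarith)
    have hp : (0 : ℝ) < 1 / (ε / 32) := by positivity
    rw [← Real.exp_log (pow_pos hp d), Real.log_pow, Real.exp_le_exp]
    exact mul_le_mul hd' h1 h0 (by positivity)
  have e2 : (1 + ε / 32) ^ (2 * m) ≤ Real.exp (ε * m / 16) := by
    have h1 : 1 + ε / 32 ≤ Real.exp (ε / 32) := by
      have := Real.add_one_le_exp (ε / 32); linarith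
    refine (pow_le_pow_left₀ (by positivity) h1 _).trans (le_of_eq ?_)
    rw [← Real.exp_nat_mul]; congr 1; push_cast; ring
  have e3 : (2 : ℝ) ^ (-(ε * m / 4)) = Real.exp (Real.log 2 * (-(ε * m / 4))) :=
    Real.rpow_def_of_pos (by norm_num) _
  have e4 : (2 : ℝ) = Real.exp (Real.log 2) := (Real.exp_log (by norm_num)).symm
  have e5 : δ = Real.exp (-Real.log (1 / δ)) := by
    rw [one_div, Real.log_inv, neg_neg, Real.exp_log hδ]
  have hlδ : 0 ≤ Real.log (1 / δ) := Real.log_nonneg (by rw [le_div_iff₀ hδ]; linarith)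
  calc 2 * (((1 / (ε / 32)) ^ d * (1 + ε / 32) ^ (2 * m)) * 2 ^ (-(ε * m / 4)))
      ≤ 2 * ((Real.exp (3 * ω * (5 * L)) * Real.exp (ε * m / 16)) * 2 ^ (-(ε * m / 4))) := by
        gcongr
    _ = Real.exp (Real.log 2 + (3 * ω * (5 * L) + ε * m / 16 + Real.log 2 * (-(ε * m / 4)))) := by
        rw [Real.exp_add, Real.exp_add, Real.exp_add, e3, ← e4]
    _ ≤ Real.exp (-Real.log (1 / δ)) := by
        rw [Real.exp_le_exp]
        have hωL : Real.log 2 ≤ ω * L := by nlinarith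
        nlinarith
    _ = δ := e5.symm

end Sampling

/-! ### Consistent learners -/

/-- The hypothesis `H` labels all examples correctly. -/
def Consistent {V : Type*} {m : ℕ} (H : Set V) (S : Fin m → V × Bool) : Prop :=
  ∀ i, (S i).2 = true ↔ (S i).1 ∈ H

/-- The labeled vertices that `H` labels incorrectly. -/
def errorSet {V : Type*} (H : Set V) : Set (V × Bool) := {z | ¬ (z.2 = true ↔ z.1 ∈ H)}

open Classical in
theorem measureReal_eq_sum {X : Type*} [Fintype X] [MeasurableSpace X]
    [MeasurableSingletonClass X] (D : Measure X) [IsFiniteMeasure D] (E : Set X) :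
    D.real E = ∑ x, if x ∈ E then D.real {x} else 0 := by
  rw [← Finset.sum_filter, sum_measureReal_singleton]
  simp

open Classical in
theorem pi_measureReal_eq_sum {X : Type*} [Fintype X] [MeasurableSpace X]
    [MeasurableSingletonClass X] (D : Measure X) [IsProbabilityMeasure D] {m : ℕ}
    (B : Set (Fin m → X)) :
    (Measure.pi fun _ : Fin m => D).real B =
      ∑ S : Fin m → X, if S ∈ B then ∏ i, D.real {S i} else 0 := by
  rw [measureReal_eq_sum]
  refine Finset.sum_congr rfl fun S _ => ?_
  congr 1
  simp [measureReal_def, Measure.pi_singleton, ENNReal.toReal_prod]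

/-- The double-sample bound is applied to the error sets of the halfspaces: a consistent output with
large error is a heavy error set missed by the sample. -/
theorem pacLearns_of_consistent {n m : ℕ} {G : SimpleGraph (Fin n)} (hG : G.Connected)
    {A : (Fin m → Fin n × Bool) → Set (Fin n)} (hA : ∀ S, A S ∈ mHalfspaces G)
    (hcons : ∀ S, (∃ H ∈ mHalfspaces G, Consistent H S) → Consistent (A S) S)
    {ε δ : ℝ} (hε : 0 < ε) (hε1 : ε < 1) (hδ : 0 < δ) (hδ1 : δ < 1)
    (hm : 200 * ((G.cliqueNum * Real.log (2 / ε) + Real.log (1 / δ)) / ε) ≤ m) :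
    PACLearnsRealizable (mHalfspaces G) m A ε δ := by
  classical
  refine ⟨hA, fun D hD ⟨Hs, hHs, hHs0⟩ => ?_⟩
  have : Nonempty (Fin n) := hG.nonempty
  have hω : 1 ≤ G.cliqueNum := one_le_cliqueNum
  set 𝓔 : Set (Set (Fin n × Bool)) := errorSet '' mHalfspaces G with h𝓔
  set w : Fin n × Bool → ℝ := fun z => D.real {z} with hwdef
  have hw : ∀ z, 0 ≤ w z := fun z => measureReal_nonneg
  have hw1 : ∑ z, w z = 1 := by
    simp only [hwdef]
    rw [sum_measureReal_singleton, Finset.coe_univ, probReal_univ]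
  have herror : ∀ H, error D H = ∑ z, if z ∈ errorSet H then w z else 0 := fun H =>
    measureReal_eq_sum D (errorSet H)
  have hm' : 4 ≤ ε * m := by
    have h1 : 200 * (G.cliqueNum * Real.log (2 / ε) + Real.log (1 / δ)) ≤ ε * m := by
      rw [← mul_div_assoc, div_le_iff₀ hε] at hm; linarith
    have h2 : Real.log 2 ≤ Real.log (2 / ε) :=
      Real.log_le_log (by norm_num) (by rw [le_div_iff₀ hε]; linarith)
    have h3 : 0.6931471803 < Real.log 2 := Real.log_two_gt_d9
    have h4 : 0 ≤ Real.log (1 / δ) := Real.log_nonneg (by rw [le_div_iff₀ hδ]; linarith)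
    have h5 : (1 : ℝ) ≤ G.cliqueNum := by exact_mod_cast hω
    nlinarith
  -- Passing from halfspaces to error sets flips each dichotomy according to the labels, which does
  -- not affect shattering.
  have hvc : ∀ (Z : Fin m × Bool → Fin n × Bool) (s : Finset (Fin m × Bool)),
      (∀ J : Set (Fin m × Bool), ∃ E ∈ 𝓔, ∀ i ∈ s, Z i ∈ E ↔ i ∈ J) →
        s.card ≤ 2 * G.cliqueNum + 1 := by
    intro Z s hs
    refine card_le_of_shattered hG (x := fun i => (Z i).1) fun J => ?_
    obtain ⟨_, ⟨H, hH, rfl⟩, hE⟩ := hs {i | ¬ ((Z i).2 = true ↔ i ∈ J)}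
    refine ⟨H, hH, fun i hi => ?_⟩
    have := hE i hi
    change ¬ _ ↔ ¬ _ at this
    tauto
  have hbad := (sum_bad_le_double hw hw1 𝓔 hε1.le hm').trans
    ((mul_le_mul_of_nonneg_left (sum_doubleBad_le hw hw1 (x := ε / 32) (by positivity)
      (by linarith) (ε * m / 4) hvc) (by norm_num)).trans
      (sample_bound_le hε hε1 hδ hδ1 hω (by omega) rfl hm))
  have hnull : ∀ z ∈ errorSet Hs, w z = 0 := by
    intro z hz
    refine le_antisymm ?_ (hw z)
    rw [← hHs0]
    exact measureReal_mono (Set.singleton_subset_iff.mpr hz)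
  have hgood := pi_measureReal_eq_sum D {S : Fin m → Fin n × Bool | error D (A S) ≤ ε}
  have htot : ∑ S : Fin m → Fin n × Bool, ∏ i, w (S i) = 1 := by
    rw [← Fintype.sum_pow, hw1, one_pow]
  -- Each sample has small output error, or has weight zero because the target mislabels one of its
  -- points, or is counted by the second sum.
  have hcompl : 1 ≤ (∑ S : Fin m → Fin n × Bool,
      if S ∈ {S : Fin m → Fin n × Bool | error D (A S) ≤ ε} then ∏ i, w (S i) else 0) +
      ∑ S : Fin m → Fin n × Bool,
        (if ∃ E ∈ 𝓔, (ε < ∑ x, if x ∈ E then w x else 0) ∧ ∀ i, S i ∉ E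
          then ∏ i, w (S i) else 0) := by
    rw [← htot, ← Finset.sum_add_distrib]
    refine Finset.sum_le_sum fun S _ => ?_
    have hpr : 0 ≤ ∏ i, w (S i) := Finset.prod_nonneg fun i _ => hw _
    by_cases h1 : error D (A S) ≤ ε
    · rw [if_pos (show S ∈ {S | error D (A S) ≤ ε} from h1)]
      have : 0 ≤ (if ∃ E ∈ 𝓔, (ε < ∑ x, if x ∈ E then w x else 0) ∧ ∀ i, S i ∉ E
          then ∏ i, w (S i) else 0) := by split_ifs <;> simp [hpr]
      linarith
    · by_cases h2 : ∃ i, S i ∈ errorSet Hs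
      · obtain ⟨i, hi⟩ := h2
        have h0 : ∏ i, w (S i) = 0 := Finset.prod_eq_zero (Finset.mem_univ i) (hnull _ hi)
        simp [h0]
      · have hc : Consistent (A S) S := hcons S ⟨Hs, hHs, fun i => by
          by_contra hi
          exact h2 ⟨i, hi⟩⟩
        have hB : ∃ E ∈ 𝓔, (ε < ∑ x, if x ∈ E then w x else 0) ∧ ∀ i, S i ∉ E := by
          refine ⟨errorSet (A S), ⟨_, hA S, rfl⟩, ?_, fun i hi => hi (hc i)⟩
          rw [← herror]
          exact not_le.mp h1
        rw [if_pos hB, if_neg (show S ∉ {S | error D (A S) ≤ ε} from h1), zero_add]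
  rw [hgood]
  linarith

/-! ### Growing arrays -/

/-- The nonzero cells of array `a` stay nonzero. -/
def Grows (a : ℕ) (M M' : Mem) : Prop := ∀ k, M a k ≠ 0 → M' a k ≠ 0

theorem Grows.refl (a : ℕ) (M : Mem) : Grows a M M := fun _ h => h

theorem Grows.trans {a : ℕ} {M M' M'' : Mem} (h : Grows a M M') (h' : Grows a M' M'') :
    Grows a M M'' := fun k hk => h' k (h k hk)

/-- All values that the program stores into array `a` are the constant one. -/
def Prog.SetsOne (a : ℕ) : Prog → Prop
  | .store b _ e => b ≠ a ∨ e = .const 1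
  | .seq p q => p.SetsOne a ∧ q.SetsOne a
  | .cond _ p => p.SetsOne a
  | .loop _ p => p.SetsOne a

theorem Prog.SetsOne.grows {a : ℕ} : ∀ {p : Prog}, p.SetsOne a →
    ∀ (d : ℕ) (env : ℕ → ℕ) (M : Mem), Grows a M (p.run d env M)
  | .store b i e, h, d, env, M, k, hk => by
      simp only [run, Mem.set_apply]
      rcases h with h | rfl
      · rwa [if_neg (by tauto)]
      · split_ifs
        · simp [Expr.eval]
        · exact hk
  | .seq p q, h, d, env, M, k, hk => h.2.grows d env _ k (h.1.grows d env M k hk)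
  | .cond e p, h, d, env, M, k, hk => by
      simp only [run]
      split_ifs
      · exact h.grows (p := p) d env M k hk
      · exact hk
  | .loop N p, h, d, env, M, k, hk =>
      run_loop_inv (fun M' => M' a k ≠ 0) hk
        (fun j _ M' hM' => h.grows (p := p) (d + 1) _ M' k hM')

/-- Whatever round `j` of a loop writes into a growing array is still there at the end. -/
theorem Prog.run_loop_visit {a d N : ℕ} {env : ℕ → ℕ} {p : Prog} {M : Mem} (hp : p.SetsOne a)
    (P : Mem → Prop) (h0 : P M)
    (step : ∀ j < env N, ∀ M', P M' → P (p.run (d + 1) (Function.update env (3 + d) j) M')) :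
    ∀ j < env N, ∃ M', P M' ∧ Grows a (p.run (d + 1) (Function.update env (3 + d) j) M')
      ((Prog.loop N p).run d env M) := by
  refine (run_loop (fun k M' => P M' ∧ ∀ j < k, ∃ M'', P M'' ∧
    Grows a (p.run (d + 1) (Function.update env (3 + d) j) M'') M') ⟨h0, by simp⟩ ?_).2
  rintro j hj M' ⟨hP, hR⟩
  refine ⟨step j hj M' hP, fun i hi => ?_⟩
  rcases Nat.lt_succ_iff_lt_or_eq.mp hi with h | rfl
  · obtain ⟨M'', h1, h2⟩ := hR i h
    exact ⟨M'', h1, h2.trans (hp.grows _ _ _)⟩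
  · exact ⟨M', hP, Grows.refl _ _⟩

theorem Prog.run_seq (d : ℕ) (env : ℕ → ℕ) (M : Mem) (p q : Prog) :
    (Prog.seq p q).run d env M = q.run d env (p.run d env M) := rfl

theorem Prog.run_cond_pos {d : ℕ} {env : ℕ → ℕ} {M : Mem} {e : Expr} {p : Prog}
    (h : e.eval ⟨env, M⟩ ≠ 0) : (Prog.cond e p).run d env M = p.run d env M := if_pos h

theorem Prog.run_cond_neg {d : ℕ} {env : ℕ → ℕ} {M : Mem} {e : Expr} {p : Prog}
    (h : ¬ e.eval ⟨env, M⟩ ≠ 0) : (Prog.cond e p).run d env M = M := if_neg h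

/-! ### Literals

The literal `x < n` says that the vertex `x` lies in the halfspace, and `x + n` that it does not. -/

/-- The opposite literal. -/
def neg (n p : ℕ) : ℕ := if p < n then p + n else p - n

theorem neg_lt {n p : ℕ} (hp : p < 2 * n) : neg n p < 2 * n := by
  unfold neg; split_ifs <;> omega

theorem neg_neg' {n p : ℕ} (hp : p < 2 * n) : neg n (neg n p) = p := by
  unfold neg; split_ifs <;> omega

theorem neg_of_lt {n x : ℕ} (hx : x < n) : neg n x = x + n := by simp [neg, hx]

theorem neg_add {n x : ℕ} : neg n (x + n) = x := by simp [neg]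

/-- Vertices on the side of `u` for every halfspace that separates the adjacent vertices `u`
and `v`. -/
def Near (E : ℕ → ℕ → Prop) (u v x : ℕ) : Prop := x = u ∨ (E u x ∧ x ≠ v ∧ ¬ E v x)

/-- Literals that hold for every halfspace containing `u` but not its neighbour `v`. -/
def Known (n : ℕ) (E : ℕ → ℕ → Prop) (u v p : ℕ) : Prop :=
  if p < n then Near E u v p else Near E v u (p - n)

/-- `T` is the set of true literals of a halfspace that contains `u`, does not contain `v` and
satisfies the sample literals `Sm`. -/
structure Sol (n : ℕ) (E : ℕ → ℕ → Prop) (Sm : ℕ → Prop) (u v : ℕ) (T : ℕ → Prop) : Prop where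
  compl : ∀ p < 2 * n, T (neg n p) ↔ ¬ T p
  sample : ∀ p < 2 * n, Sm p → T p
  pos : T u
  negative : T (v + n)
  border : ∀ a < n, ∀ b < n, ∀ c < n, ∀ d < n, E a b → E c d → a ≠ c → ¬ E a c →
    ¬ (T a ∧ T (b + n) ∧ T c ∧ T (d + n)) ∧ ¬ (T (a + n) ∧ T b ∧ T (c + n) ∧ T d)

/-- If a vertex adjacent to `u` but not to `v` were outside, then it and `v` would be two
nonadjacent border vertices of the complement, both witnessed by `u`. The other side is symmetric.
-/
theorem Sol.known {n : ℕ} {E : ℕ → ℕ → Prop} {Sm : ℕ → Prop} {u v : ℕ} {T : ℕ → Prop}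
    (hT : Sol n E Sm u v T) (hE : ∀ i j, E i j → E j i) (hu : u < n) (hv : v < n) (huv : E u v)
    {p : ℕ} (hp : p < 2 * n) (hK : Known n E u v p) : T p := by
  unfold Known at hK
  split_ifs at hK with h
  · rcases hK with rfl | ⟨h1, h2, h3⟩
    · exact hT.pos
    · by_contra hnp
      have hpn := (hT.compl p hp).mpr hnp
      rw [neg_of_lt h] at hpn
      exact (hT.border p h u hu v hv u hu (hE _ _ h1) (hE _ _ huv) h2
        (fun h => h3 (hE _ _ h))).2 ⟨hpn, hT.pos, hT.negative, hT.pos⟩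
  · obtain ⟨x, rfl⟩ : ∃ x, p = x + n := ⟨p - n, by omega⟩
    rw [Nat.add_sub_cancel] at hK
    rcases hK with rfl | ⟨h1, h2, h3⟩
    · exact hT.negative
    · by_contra hnp
      have hpn := (hT.compl _ hp).mpr hnp
      rw [neg_add] at hpn
      exact (hT.border x (by omega) v hv u hu v hv (hE _ _ h1) huv h2
        (fun h => h3 (hE _ _ h))).1 ⟨hpn, hT.negative, hT.pos, hT.negative⟩

/-- The binary clauses derived from a quadruple of literals that are not all true. -/
def PairClauses (K : ℕ → Prop) (W : ℕ → ℕ → Prop) (A B C D : ℕ) : Prop :=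
  (K B → K D → W A C) ∧ (K C → K D → W A B) ∧ (K A → K C → W B D) ∧ (K B → K C → W A D)

/-- The heart of the reduction to 2-SAT. In a violated quadruple, comparison with the cut edge makes
`a` and `c` equal or adjacent to `u`; as they are nonadjacent, both differ from `u` and are adjacent
to it. Whichever of them is adjacent to `v` can take `v` as its outside neighbour, and whichever is
not is `Near` to `u`. In all four cases two literals of the resulting quadruple are known, so a
binary clause is violated. Four of the six pairs suffice in `PairClauses`, because exchanging the
two edges gives the other two. `X` and `Y` are abstract so that the lemma serves both sides of the
cut. -/
theorem border_of_pairs {n : ℕ} {E : ℕ → ℕ → Prop} (hE : ∀ i j, E i j → E j i) {u v : ℕ}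
    (hu : u < n) (hv : v < n) (huv : E u v) {X Y : ℕ → Prop} (hXY : ∀ x < n, ¬ (X x ∧ Y x))
    (hY : Y v)
    (h1 : ∀ a < n, ∀ b < n, ∀ c < n, ∀ d < n, E a b → E c d → a ≠ c → ¬ E a c →
      (Near E v u b → Near E v u d → ¬ (X a ∧ X c)) ∧
      (Near E u v c → Near E v u d → ¬ (X a ∧ Y b)) ∧
      (Near E u v a → Near E u v c → ¬ (Y b ∧ Y d)) ∧
      (Near E v u b → Near E u v c → ¬ (X a ∧ Y d)))
    {a b c d : ℕ} (ha : a < n) (hb : b < n) (hc : c < n) (hd : d < n) (hab : E a b) (hcd : E c d)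
    (hac : a ≠ c) (hnac : ¬ E a c) : ¬ (X a ∧ Y b ∧ X c ∧ Y d) := by
  rintro ⟨Xa, Yb, Xc, Yd⟩
  have Ku : Near E u v u := Or.inl rfl
  have Kv : Near E v u v := Or.inl rfl
  have hua : a ≠ u → E u a := by
    intro h
    by_contra h'
    exact (h1 a ha b hb u hu v hv hab huv h fun h => h' (hE _ _ h)).2.1 Ku Kv ⟨Xa, Yb⟩
  have huc : c ≠ u → E u c := by
    intro h
    by_contra h'
    exact (h1 c hc d hd u hu v hv hcd huv h fun h => h' (hE _ _ h)).2.1 Ku Kv ⟨Xc, Yd⟩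
  have hau : a ≠ u := by
    rintro rfl
    exact hnac (huc hac.symm)
  have hcu : c ≠ u := by
    rintro rfl
    exact hnac (hE _ _ (hua hac))
  have hav : a ≠ v := by rintro rfl; exact hXY _ ha ⟨Xa, hY⟩
  have hcv : c ≠ v := by rintro rfl; exact hXY _ hc ⟨Xc, hY⟩
  by_cases hva : E v a <;> by_cases hvc : E v c
  · exact (h1 a ha v hv c hc v hv (hE _ _ hva) (hE _ _ hvc) hac hnac).1 Kv Kv ⟨Xa, Xc⟩
  · exact (h1 a ha v hv c hc d hd (hE _ _ hva) hcd hac hnac).2.2.2 Kv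
      (Or.inr ⟨huc hcu, hcv, hvc⟩) ⟨Xa, Yd⟩
  · exact (h1 c hc v hv a ha b hb (hE _ _ hvc) hab hac.symm fun h => hnac (hE _ _ h)).2.2.2 Kv
      (Or.inr ⟨hua hau, hav, hva⟩) ⟨Xc, Yb⟩
  · exact (h1 a ha b hb c hc d hd hab hcd hac hnac).2.2.1 (Or.inr ⟨hua hau, hav, hva⟩)
      (Or.inr ⟨huc hcu, hcv, hvc⟩) ⟨Yb, Yd⟩

theorem known_of_lt {n : ℕ} {E : ℕ → ℕ → Prop} {u v x : ℕ} (hx : x < n) :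
    Known n E u v x ↔ Near E u v x := by simp [Known, hx]

theorem known_add {n : ℕ} {E : ℕ → ℕ → Prop} {u v x : ℕ} :
    Known n E u v (x + n) ↔ Near E v u x := by simp [Known]

theorem sol_of_pairs {n : ℕ} {E : ℕ → ℕ → Prop} {Sm : ℕ → Prop} {u v : ℕ} {T : ℕ → Prop}
    (hE : ∀ i j, E i j → E j i) (hu : u < n) (hv : v < n) (huv : E u v)
    (compl : ∀ p < 2 * n, T (neg n p) ↔ ¬ T p) (sample : ∀ p < 2 * n, Sm p → T p)
    (known : ∀ p < 2 * n, Known n E u v p → T p)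
    (h : ∀ a < n, ∀ b < n, ∀ c < n, ∀ d < n, E a b → E c d → a ≠ c → ¬ E a c →
      PairClauses (Known n E u v) (fun p q => ¬ (T p ∧ T q)) a (b + n) c (d + n) ∧
      PairClauses (Known n E u v) (fun p q => ¬ (T p ∧ T q)) (a + n) b (c + n) d) :
    Sol n E Sm u v T := by
  have pos : T u := known u (by omega) ((known_of_lt hu).mpr (Or.inl rfl))
  have negative : T (v + n) := known (v + n) (by omega) (known_add.mpr (Or.inl rfl))
  have hcons : ∀ x < n, ¬ (T x ∧ T (x + n)) := by
    rintro x hx ⟨h1, h2⟩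
    have := compl x (by omega)
    rw [neg_of_lt hx] at this
    exact this.mp h2 h1
  refine ⟨compl, sample, pos, negative, ?_⟩
  intro a ha b hb c hc d hd hab hcd hac hnac
  constructor
  · refine border_of_pairs (X := T) (Y := fun x => T (x + n)) hE hu hv huv hcons negative ?_
      ha hb hc hd hab hcd hac hnac
    intro a ha b hb c hc d hd hab hcd hac hnac
    have := (h a ha b hb c hc d hd hab hcd hac hnac).1
    simpa only [PairClauses, known_of_lt ha, known_of_lt hc, known_add] using this
  · refine border_of_pairs (X := fun x => T (x + n)) (Y := T) hE hv hu (hE _ _ huv)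
      (fun x hx h => hcons x hx h.symm) pos ?_ ha hb hc hd hab hcd hac hnac
    intro a ha b hb c hc d hd hab hcd hac hnac
    have := (h a ha b hb c hc d hd hab hcd hac hnac).2
    simpa only [PairClauses, known_of_lt hb, known_of_lt hd, known_add] using this

theorem pairClauses_of_not_all {T K : ℕ → Prop} {A B C D : ℕ} (h : ¬ (T A ∧ T B ∧ T C ∧ T D))
    (hA : K A → T A) (hB : K B → T B) (hC : K C → T C) (hD : K D → T D) :
    PairClauses K (fun p q => ¬ (T p ∧ T q)) A B C D := by
  unfold PairClauses
  tauto

/-! ### The program for a fixed cut edge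

Array `0` is the adjacency matrix, `3` the output, `4` the sample literals, `5` and `6` hold the
row offsets of matrices with `n` and `2 n` columns, `7` the known literals, `8` the matrix of
conflicting pairs of literals, `9` the negation of literals, `10` the literals set true, `11` a
flag. -/

/-- Entry of the adjacency matrix. -/
def adjE (i j : Expr) : Expr := .read 0 (.add (.read 5 i) j)

/-- One if the values agree and zero otherwise. -/
def eqE (i j : Expr) : Expr := .sub (.const 1) (.add (.sub i j) (.sub j i))

/-- Entry of the conflict matrix. -/
def confE (p q : Expr) : Expr := .read 8 (.add (.read 6 p) q)

/-- Empties the conflict matrix. -/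
def clearConf : Prog :=
  .loop 2 (.loop 2 (.store 8 (.add (.read 6 (.var 5)) (.var 6)) (.const 0)))

/-- Empties the set of true literals. -/
def clearVal : Prog := .loop 2 (.store 10 (.var 5) (.const 0))

/-- Computes the known literals. -/
def computeKnown : Prog :=
  .loop 0 (.seq
    (.store 7 (.var 5) (.add (eqE (.var 5) (.var 3))
      (.sub (adjE (.var 3) (.var 5)) (.add (adjE (.var 4) (.var 5)) (eqE (.var 5) (.var 4))))))
    (.store 7 (.add (.var 5) (.var 0)) (.add (eqE (.var 5) (.var 4))
      (.sub (adjE (.var 4) (.var 5)) (.add (adjE (.var 3) (.var 5)) (eqE (.var 5) (.var 3)))))))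

/-- Lets the negations of the known literals and of the sample literals conflict with
themselves. -/
def addUnits : Prog :=
  .loop 2 (.cond (.add (.read 7 (.read 9 (.var 5))) (.read 4 (.read 9 (.var 5))))
    (.store 8 (.add (.read 6 (.var 5)) (.var 5)) (.const 1)))

/-- Marks a conflict. -/
def setConf (p q : Expr) : Prog :=
  .seq (.store 8 (.add (.read 6 p) q) (.const 1)) (.store 8 (.add (.read 6 q) p) (.const 1))

/-- Marks a conflict if two other literals are known. -/
def setConfIf (x y p q : Expr) : Prog := .cond (.read 7 x) (.cond (.read 7 y) (setConf p q))

/-- Adds the binary clauses of a quadruple of literals. -/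
def addPairs (A B C D : Expr) : Prog :=
  .seq (setConfIf B D A C) (.seq (setConfIf C D A B) (.seq (setConfIf A C B D)
    (setConfIf B C A D)))

/-- Adds the binary clauses of a quadruple of vertices. -/
def addQuadruple : Prog :=
  .cond (adjE (.var 5) (.var 6)) (.cond (adjE (.var 7) (.var 8))
    (.cond (.sub (.const 1) (eqE (.var 5) (.var 7)))
      (.cond (.sub (.const 1) (adjE (.var 5) (.var 7)))
        (.seq
          (addPairs (.var 5) (.add (.var 6) (.var 0)) (.var 7) (.add (.var 8) (.var 0)))
          (addPairs (.add (.var 5) (.var 0)) (.var 6) (.add (.var 7) (.var 0)) (.var 8))))))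

/-- Adds all binary clauses. -/
def addClauses : Prog := .loop 0 (.loop 0 (.loop 0 (.loop 0 addQuadruple)))

/-- Closes the conflict matrix under resolution. -/
def closeConf : Prog :=
  .loop 2 (.loop 2 (.loop 2 (.cond (confE (.var 6) (.var 5))
    (.cond (confE (.read 9 (.var 5)) (.var 7))
      (.store 8 (.add (.read 6 (.var 6)) (.var 7)) (.const 1))))))

/-- Sets a literal and its consequences true. -/
def setTrue : Prog :=
  .seq
    (.loop 2 (.cond (confE (.var 5) (.read 9 (.var 6))) (.store 10 (.var 6) (.const 1))))
    (.store 10 (.var 5) (.const 1))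

/-- Sets literals true as long as possible. -/
def greedy : Prog :=
  .loop 2 (.cond (.sub (.const 1) (.add (.add (.read 10 (.var 5)) (.read 10 (.read 9 (.var 5))))
    (confE (.var 5) (.var 5)))) setTrue)

/-- Sets the flag to one if the expression vanishes for all values of the loop variable, and to
zero otherwise. -/
def checkNone (e : Expr) : Prog :=
  .seq (.store 11 (.const 0) (.const 1)) (.loop 0 (.cond e (.store 11 (.const 0) (.const 0))))

/-- Copies the true literals to the output if they decide every vertex. -/
def publish : Prog :=
  .seq (checkNone (.sub (.const 1) (.add (.read 10 (.var 5)) (.read 10 (.add (.var 5) (.var 0))))))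
    (.cond (.read 11 (.const 0))
      (.loop 0 (.store 3 (.var 5) (.sub (.const 1) (.sub (.const 1) (.read 10 (.var 5)))))))

/-- Looks for a halfspace that contains vertex `var 3` but not its neighbour `var 4`. -/
def solve : Prog :=
  .seq clearConf (.seq clearVal (.seq computeKnown (.seq addUnits (.seq addClauses
    (.seq closeConf (.seq greedy publish))))))

/-- The input tables are in place. -/
structure Tables (n : ℕ) (E : ℕ → ℕ → Prop) (Sm : ℕ → Prop) (M : Mem) : Prop where
  adj : ∀ i < n, ∀ j < n, (E i j ∧ M 0 (i * n + j) = 1) ∨ (¬ E i j ∧ M 0 (i * n + j) = 0)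
  off : ∀ i < n, M 5 i = i * n
  offLit : ∀ p < 2 * n, M 6 p = p * (2 * n)
  neg : ∀ p < 2 * n, M 9 p = neg n p
  sample : ∀ p < 2 * n, M 4 p ≠ 0 ↔ Sm p

theorem Tables.congr {n : ℕ} {E : ℕ → ℕ → Prop} {Sm : ℕ → Prop} {M M' : Mem}
    (h : Tables n E Sm M) (h' : ∀ a ∈ [0, 4, 5, 6, 9], M' a = M a) : Tables n E Sm M' := by
  simp only [List.mem_cons, List.not_mem_nil, or_false, forall_eq_or_imp, forall_eq] at h'
  obtain ⟨h0, h4, h5, h6, h9⟩ := h'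
  constructor
  · rw [h0]; exact h.adj
  · rw [h5]; exact h.off
  · rw [h6]; exact h.offLit
  · rw [h9]; exact h.neg
  · rw [h4]; exact h.sample

/-- The values of the variables in the scope of `solve`. -/
structure EnvOK (n u v : ℕ) (env : ℕ → ℕ) : Prop where
  size : env 0 = n
  lits : env 2 = 2 * n
  src : env 3 = u
  dst : env 4 = v

/-- The pair of literals is marked as conflicting. -/
def Conf (n : ℕ) (M : Mem) (p q : ℕ) : Prop := M 8 (p * (2 * n) + q) ≠ 0

theorem index_inj {N p q p' q' : ℕ} (hq : q < N) (hq' : q' < N) :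
    p * N + q = p' * N + q' ↔ p = p' ∧ q = q' := by
  constructor
  · intro h
    have h1 : q = q' := by
      have := congrArg (· % N) h
      simpa [Nat.mul_add_mod', Nat.mod_eq_of_lt hq, Nat.mod_eq_of_lt hq'] using this
    subst h1
    exact ⟨Nat.eq_of_mul_eq_mul_right (by omega) (by omega : p * N = p' * N), rfl⟩
  · rintro ⟨rfl, rfl⟩; rfl

theorem conf_set {n : ℕ} {M : Mem} {p q p' q' : ℕ} (hq : q < 2 * n) (hq' : q' < 2 * n) :
    Conf n (M.set 8 (p' * (2 * n) + q') 1) p q ↔ (p = p' ∧ q = q') ∨ Conf n M p q := by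
  unfold Conf
  rw [Mem.set_apply]
  by_cases h : p = p' ∧ q = q'
  · simp [h]
  · rw [if_neg (by rw [index_inj hq hq']; tauto)]
    tauto

theorem conf_congr {n : ℕ} {M M' : Mem} (h : M' 8 = M 8) : Conf n M' = Conf n M := by
  unfold Conf; rw [h]

/-! ### Correctness of the phases that build the clauses -/

section Phases

variable {n u v : ℕ} {env : ℕ → ℕ} {E : ℕ → ℕ → Prop} {Sm : ℕ → Prop} {M : Mem}

theorem clearConf_spec (he : EnvOK n u v env) (hM : Tables n E Sm M) {p q : ℕ} (hp : p < 2 * n)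
    (hq : q < 2 * n) : ¬ Conf n (clearConf.run 2 env M) p q := by
  have key := Prog.run_loop_forall (d := 2) (N := 2) (env := env) (M := M)
    (p := .loop 2 (.store 8 (.add (.read 6 (.var 5)) (.var 6)) (.const 0)))
    (fun M' => M' 6 = M 6) (fun i M' => ∀ j < 2 * n, M' 8 (i * (2 * n) + j) = 0) rfl ?_
  · intro h
    exact h (key.2 p (by rw [he.lits]; exact hp) q hq)
  · intro i hi M' hM'
    rw [he.lits] at hi
    have inner := Prog.run_loop_forall (d := 3) (N := 2) (env := Function.update env 5 i) (M := M')
      (p := .store 8 (.add (.read 6 (.var 5)) (.var 6)) (.const 0))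
      (fun M' => M' 6 = M 6) (fun j M' => M' 8 (i * (2 * n) + j) = 0) hM' (by
        intro j hj M'' hM''
        simp only [Prog.run, Expr.eval, Nat.reduceAdd, Function.update_self, ne_eq,
          Nat.reduceEqDiff, not_false_eq_true, Function.update_of_ne, hM'', hM.offLit i hi]
        refine ⟨by simp [Mem.set, hM''], by simp, fun j' _ _ hj' => ?_⟩
        rw [Mem.set_apply]
        split_ifs <;> simp [hj'])
    simp only [ne_eq, Nat.reduceEqDiff, not_false_eq_true, Function.update_of_ne, he.lits] at inner
    refine ⟨inner.1, inner.2, ?_⟩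
    intro i' _ _ hi'
    refine (Prog.run_loop_inv (d := 3) (N := 2) (env := Function.update env 5 i) (M := M')
      (p := .store 8 (.add (.read 6 (.var 5)) (.var 6)) (.const 0))
      (fun M' => ∀ j < 2 * n, M' 8 (i' * (2 * n) + j) = 0) hi' ?_)
    intro j _ M'' hM'' k hk
    simp only [Prog.run, Mem.set_apply, Expr.eval]
    split_ifs
    · rfl
    · exact hM'' k hk

theorem clearVal_spec (he : EnvOK n u v env) {p : ℕ} (hp : p < 2 * n) :
    clearVal.run 2 env M 10 p = 0 := by
  have key := Prog.run_loop_forall (d := 2) (N := 2) (env := env) (M := M)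
    (p := .store 10 (.var 5) (.const 0)) (fun _ => True) (fun i M' => M' 10 i = 0) trivial (by
      intro j _ M' _
      simp only [Prog.run, Expr.eval, Nat.reduceAdd, Function.update_self]
      refine ⟨trivial, by simp, fun i _ _ hi => ?_⟩
      rw [Mem.set_apply]; split_ifs <;> simp [hi])
  exact key.2 p (by rw [he.lits]; exact hp)

/-- On 0/1 values, addition acts as disjunction and truncated subtraction as "and not", so the
stored expression is nonzero exactly when `Near` holds. -/
theorem computeKnown_spec (he : EnvOK n u v env) (hM : Tables n E Sm M) (hu : u < n) (hv : v < n)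
    {p : ℕ} (hp : p < 2 * n) : computeKnown.run 2 env M 7 p ≠ 0 ↔ Known n E u v p := by
  have key := Prog.run_loop_forall (d := 2) (N := 0) (env := env) (M := M)
    (p := .seq
    (.store 7 (.var 5) (.add (eqE (.var 5) (.var 3))
      (.sub (adjE (.var 3) (.var 5)) (.add (adjE (.var 4) (.var 5)) (eqE (.var 5) (.var 4))))))
    (.store 7 (.add (.var 5) (.var 0)) (.add (eqE (.var 5) (.var 4))
      (.sub (adjE (.var 4) (.var 5)) (.add (adjE (.var 3) (.var 5)) (eqE (.var 5) (.var 3)))))))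
    (fun M' => M' 0 = M 0 ∧ M' 5 = M 5)
    (fun x M' => (M' 7 x ≠ 0 ↔ Near E u v x) ∧ (M' 7 (x + n) ≠ 0 ↔ Near E v u x)) ⟨rfl, rfl⟩ ?_
  · have h2 := key.2
    rw [he.size] at h2
    by_cases h : p < n
    · rw [known_of_lt h]; exact (h2 p h).1
    · obtain ⟨x, rfl⟩ : ∃ x, p = x + n := ⟨p - n, by omega⟩
      rw [known_add]; exact (h2 x (by omega)).2
  · rintro x hx M' ⟨h0, h5⟩
    rw [he.size] at hx
    have hvals : ∀ y z, y < n → z < n → (E y z ∧ M 0 (y * n + z) = 1) ∨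
      (¬ E y z ∧ M 0 (y * n + z) = 0) := fun y z hy hz => hM.adj y hy z hz
    have hrun : ∀ A B : Expr, (Prog.seq (.store 7 (.var 5) A)
        (.store 7 (.add (.var 5) (.var 0)) B)).run 3 (Function.update env 5 x) M' =
        (M'.set 7 x (A.eval ⟨Function.update env 5 x, M'⟩)).set 7 (x + n)
          (B.eval ⟨Function.update env 5 x,
            M'.set 7 x (A.eval ⟨Function.update env 5 x, M'⟩)⟩) := by
      intro A B
      simp [Prog.run, Expr.eval, he.size]
    rw [show 3 + 2 = 5 from rfl, show 2 + 1 = 3 from rfl, hrun]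
    have hs0 : ∀ k l, M'.set 7 k l 0 = M 0 := fun k l => by simp [Mem.set, h0]
    have hs5 : ∀ k l, M'.set 7 k l 5 = M 5 := fun k l => by simp [Mem.set, h5]
    simp only [Expr.eval, eqE, adjE, Function.update_self, ne_eq,
      Nat.reduceEqDiff, not_false_eq_true, Function.update_of_ne, he.src, he.dst, h0, h5, hs0, hs5,
      hM.off u hu, hM.off v hv]
    refine ⟨by simp [Mem.set, h0, h5], ⟨?_, ?_⟩, ?_⟩
    · rw [Mem.set_apply, if_neg (by omega), Mem.set_same]
      unfold Near
      rcases hvals u x hu hx with ⟨e1, e1'⟩ | ⟨e1, e1'⟩ <;>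
      rcases hvals v x hv hx with ⟨e2, e2'⟩ | ⟨e2, e2'⟩ <;>
      simp only [e1, e1', e2, e2', true_and, false_and, or_false, not_true, not_false_eq_true,
        and_true, and_false] <;> omega
    · rw [Mem.set_same]
      unfold Near
      rcases hvals u x hu hx with ⟨e1, e1'⟩ | ⟨e1, e1'⟩ <;>
      rcases hvals v x hv hx with ⟨e2, e2'⟩ | ⟨e2, e2'⟩ <;>
      simp only [e1, e1', e2, e2', true_and, false_and, or_false, not_true, not_false_eq_true,
        and_true, and_false] <;> omega
    · intro y hy hyx hR
      rw [he.size] at hy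
      simp only [Mem.set_apply]
      rw [if_neg (by omega), if_neg (by omega), if_neg (by omega), if_neg (by omega)]
      exact hR

/-- The conflict matrix is symmetric and contained in `W`, and the other arrays are as in `M₀`. -/
structure ConfInv (n : ℕ) (W : ℕ → ℕ → Prop) (M₀ M : Mem) : Prop where
  frame : ∀ a, a ≠ 8 → M a = M₀ a
  sound : ∀ p < 2 * n, ∀ q < 2 * n, Conf n M p q → W p q
  symm : ∀ p < 2 * n, ∀ q < 2 * n, Conf n M p q → Conf n M q p

variable {W : ℕ → ℕ → Prop} {K : ℕ → Prop} {M₀ : Mem}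

theorem setConf_spec (hW : ∀ p q, W p q → W q p) (hM₀ : Tables n E Sm M₀)
    (hM : ConfInv n W M₀ M) {P Q : Expr} {d p q : ℕ} (hP : ∀ M', P.eval ⟨env, M'⟩ = p)
    (hQ : ∀ M', Q.eval ⟨env, M'⟩ = q) (hp : p < 2 * n) (hq : q < 2 * n) (hpq : W p q) :
    ConfInv n W M₀ ((setConf P Q).run d env M) ∧
      Conf n ((setConf P Q).run d env M) p q := by
  have h6 : M 6 = M₀ 6 := hM.frame 6 (by norm_num)
  have h6' : ∀ k l, M.set 8 k l 6 = M₀ 6 := fun k l => by simp [Mem.set, h6]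
  simp only [setConf, Prog.run, Expr.eval, hP, hQ, h6, h6', hM₀.offLit p hp, hM₀.offLit q hq]
  refine ⟨⟨fun a ha => ?_, fun r hr s hs h => ?_, fun r hr s hs h => ?_⟩, ?_⟩
  · rw [← hM.frame a ha]; simp [Mem.set, ha]
  · rw [conf_set hs hp, conf_set hs hq] at h
    rcases h with ⟨rfl, rfl⟩ | ⟨rfl, rfl⟩ | h
    · exact hW _ _ hpq
    · exact hpq
    · exact hM.sound r hr s hs h
  · rw [conf_set hs hp, conf_set hs hq] at h
    rw [conf_set hr hp, conf_set hr hq]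
    have := hM.symm r hr s hs
    tauto
  · rw [conf_set hq hp, conf_set hq hq]; simp

theorem setConfIf_spec (hW : ∀ p q, W p q → W q p) (hM₀ : Tables n E Sm M₀)
    (hK : ∀ p < 2 * n, M₀ 7 p ≠ 0 ↔ K p)
    (hM : ConfInv n W M₀ M) {X Y P Q : Expr} {d x y p q : ℕ} (hX : ∀ M', X.eval ⟨env, M'⟩ = x)
    (hY : ∀ M', Y.eval ⟨env, M'⟩ = y) (hP : ∀ M', P.eval ⟨env, M'⟩ = p)
    (hQ : ∀ M', Q.eval ⟨env, M'⟩ = q) (hx : x < 2 * n) (hy : y < 2 * n) (hp : p < 2 * n)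
    (hq : q < 2 * n) (hpq : K x → K y → W p q) :
    ConfInv n W M₀ ((setConfIf X Y P Q).run d env M) ∧
      (K x → K y → Conf n ((setConfIf X Y P Q).run d env M) p q) := by
  have h7 : M 7 = M₀ 7 := hM.frame 7 (by norm_num)
  have cx : (Expr.read 7 X).eval ⟨env, M⟩ ≠ 0 ↔ K x := by
    simp only [Expr.eval, hX, h7]; exact hK x hx
  have cy : (Expr.read 7 Y).eval ⟨env, M⟩ ≠ 0 ↔ K y := by
    simp only [Expr.eval, hY, h7]; exact hK y hy
  unfold setConfIf
  by_cases kx : K x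
  · rw [Prog.run_cond_pos (cx.mpr kx)]
    by_cases ky : K y
    · rw [Prog.run_cond_pos (cy.mpr ky)]
      have := setConf_spec (d := d) hW hM₀ hM hP hQ hp hq (hpq kx ky)
      exact ⟨this.1, fun _ _ => this.2⟩
    · rw [Prog.run_cond_neg (cy.not.mpr ky)]
      exact ⟨hM, fun _ h => absurd h ky⟩
  · rw [Prog.run_cond_neg (cx.not.mpr kx)]
    exact ⟨hM, fun h => absurd h kx⟩

theorem setConfIf_setsOne (X Y P Q : Expr) : (setConfIf X Y P Q).SetsOne 8 := by
  simp [setConfIf, setConf, Prog.SetsOne]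

theorem addPairs_setsOne (X Y P Q : Expr) : (addPairs X Y P Q).SetsOne 8 :=
  ⟨setConfIf_setsOne _ _ _ _, setConfIf_setsOne _ _ _ _, setConfIf_setsOne _ _ _ _,
    setConfIf_setsOne _ _ _ _⟩

theorem addPairs_spec (hW : ∀ p q, W p q → W q p) (hM₀ : Tables n E Sm M₀)
    (hK : ∀ p < 2 * n, M₀ 7 p ≠ 0 ↔ K p)
    (hM : ConfInv n W M₀ M) {A B C D : Expr} {k a b c d : ℕ} (hA : ∀ M', A.eval ⟨env, M'⟩ = a)
    (hB : ∀ M', B.eval ⟨env, M'⟩ = b) (hC : ∀ M', C.eval ⟨env, M'⟩ = c)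
    (hD : ∀ M', D.eval ⟨env, M'⟩ = d) (ha : a < 2 * n) (hb : b < 2 * n) (hc : c < 2 * n)
    (hd : d < 2 * n) (hpairs : PairClauses K W a b c d) :
    ConfInv n W M₀ ((addPairs A B C D).run k env M) ∧
      PairClauses K (Conf n ((addPairs A B C D).run k env M)) a b c d := by
  obtain ⟨w1, w2, w3, w4⟩ := hpairs
  have s1 := setConfIf_spec (d := k) hW hM₀ hK hM hB hD hA hC hb hd ha hc w1
  have s2 := setConfIf_spec (d := k) hW hM₀ hK s1.1 hC hD hA hB hc hd ha hb w2
  have s3 := setConfIf_spec (d := k) hW hM₀ hK s2.1 hA hC hB hD ha hc hb hd w3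
  have s4 := setConfIf_spec (d := k) hW hM₀ hK s3.1 hB hC hA hD hb hc ha hd w4
  have g2 := (setConfIf_setsOne C D A B).grows k env ((setConfIf B D A C).run k env M)
  have g3 := (setConfIf_setsOne A C B D).grows k env
    ((setConfIf C D A B).run k env ((setConfIf B D A C).run k env M))
  have g4 := (setConfIf_setsOne B C A D).grows k env
    ((setConfIf A C B D).run k env ((setConfIf C D A B).run k env
      ((setConfIf B D A C).run k env M)))
  exact ⟨s4.1, fun h h' => g4 _ (g3 _ (g2 _ (s1.2 h h'))), fun h h' => g4 _ (g3 _ (s2.2 h h')),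
    fun h h' => g4 _ (s3.2 h h'), s4.2⟩

theorem addQuadruple_setsOne : addQuadruple.SetsOne 8 :=
  ⟨addPairs_setsOne _ _ _ _, addPairs_setsOne _ _ _ _⟩

theorem PairClauses.mono {K : ℕ → Prop} {W W' : ℕ → ℕ → Prop} {A B C D : ℕ}
    (h : PairClauses K W A B C D) (hW : ∀ p q, W p q → W' p q) : PairClauses K W' A B C D :=
  ⟨fun x y => hW _ _ (h.1 x y), fun x y => hW _ _ (h.2.1 x y), fun x y => hW _ _ (h.2.2.1 x y),
    fun x y => hW _ _ (h.2.2.2 x y)⟩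

theorem addQuadruple_spec (hW : ∀ p q, W p q → W q p) (hM₀ : Tables n E Sm M₀)
    (hK : ∀ p < 2 * n, M₀ 7 p ≠ 0 ↔ K p) (hM : ConfInv n W M₀ M) {e : ℕ → ℕ} {k a b c d : ℕ}
    (h0 : e 0 = n) (h5 : e 5 = a) (h6 : e 6 = b) (h7 : e 7 = c) (h8 : e 8 = d)
    (ha : a < n) (hb : b < n) (hc : c < n) (hd : d < n)
    (hpairs : E a b → E c d → a ≠ c → ¬ E a c →
      PairClauses K W a (b + n) c (d + n) ∧ PairClauses K W (a + n) b (c + n) d) :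
    ConfInv n W M₀ (addQuadruple.run k e M) ∧ (E a b → E c d → a ≠ c → ¬ E a c →
      PairClauses K (Conf n (addQuadruple.run k e M)) a (b + n) c (d + n) ∧
      PairClauses K (Conf n (addQuadruple.run k e M)) (a + n) b (c + n) d) := by
  have f0 : M 0 = M₀ 0 := hM.frame 0 (by norm_num)
  have f5 : M 5 = M₀ 5 := hM.frame 5 (by norm_num)
  have c1 : (adjE (.var 5) (.var 6)).eval ⟨e, M⟩ ≠ 0 ↔ E a b := by
    simp only [adjE, Expr.eval, h5, h6, f0, f5, hM₀.off a ha]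
    rcases hM₀.adj a ha b hb with h | h <;> simp [h]
  have c2 : (adjE (.var 7) (.var 8)).eval ⟨e, M⟩ ≠ 0 ↔ E c d := by
    simp only [adjE, Expr.eval, h7, h8, f0, f5, hM₀.off c hc]
    rcases hM₀.adj c hc d hd with h | h <;> simp [h]
  have c3 : (Expr.sub (.const 1) (eqE (.var 5) (.var 7))).eval ⟨e, M⟩ ≠ 0 ↔ a ≠ c := by
    simp only [eqE, Expr.eval, h5, h7]; omega
  have c4 : (Expr.sub (.const 1) (adjE (.var 5) (.var 7))).eval ⟨e, M⟩ ≠ 0 ↔ ¬ E a c := by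
    simp only [adjE, Expr.eval, h5, h7, f0, f5, hM₀.off a ha]
    rcases hM₀.adj a ha c hc with h | h <;> simp [h]
  unfold addQuadruple
  by_cases e1 : E a b
  swap
  · rw [Prog.run_cond_neg (c1.not.mpr e1)]; exact ⟨hM, fun h => absurd h e1⟩
  rw [Prog.run_cond_pos (c1.mpr e1)]
  by_cases e2 : E c d
  swap
  · rw [Prog.run_cond_neg (c2.not.mpr e2)]; exact ⟨hM, fun _ h => absurd h e2⟩
  rw [Prog.run_cond_pos (c2.mpr e2)]
  by_cases e3 : a ≠ c
  swap
  · rw [Prog.run_cond_neg (c3.not.mpr e3)]; exact ⟨hM, fun _ _ h => absurd h e3⟩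
  rw [Prog.run_cond_pos (c3.mpr e3)]
  by_cases e4 : ¬ E a c
  swap
  · rw [Prog.run_cond_neg (c4.not.mpr e4)]; exact ⟨hM, fun _ _ _ h => absurd h e4⟩
  rw [Prog.run_cond_pos (c4.mpr e4)]
  obtain ⟨w1, w2⟩ := hpairs e1 e2 e3 e4
  have s1 := addPairs_spec (env := e) (k := k) (A := .var 5) (B := .add (.var 6) (.var 0))
    (C := .var 7) (D := .add (.var 8) (.var 0)) hW hM₀ hK hM (by simp [Expr.eval, h5])
    (by simp [Expr.eval, h6, h0]) (by simp [Expr.eval, h7]) (by simp [Expr.eval, h8, h0])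
    (by omega) (by omega) (by omega) (by omega) w1
  have s2 := addPairs_spec (env := e) (k := k) (A := .add (.var 5) (.var 0)) (B := .var 6)
    (C := .add (.var 7) (.var 0)) (D := .var 8) hW hM₀ hK s1.1 (by simp [Expr.eval, h5, h0])
    (by simp [Expr.eval, h6]) (by simp [Expr.eval, h7, h0]) (by simp [Expr.eval, h8])
    (by omega) (by omega) (by omega) (by omega) w2
  have g := (addPairs_setsOne (.add (.var 5) (.var 0)) (.var 6) (.add (.var 7) (.var 0))
    (.var 8)).grows k e ((addPairs (.var 5) (.add (.var 6) (.var 0)) (.var 7)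
      (.add (.var 8) (.var 0))).run k e M)
  rw [Prog.run_seq]
  exact ⟨s2.1, fun _ _ _ _ => ⟨s1.2.mono fun p q h => g _ h, s2.2⟩⟩

end Phases

/-! ### All clauses, resolution closure, greedy assignment and output -/

section Phases

variable {n u v : ℕ} {env : ℕ → ℕ} {E : ℕ → ℕ → Prop} {Sm : ℕ → Prop} {M M₀ : Mem}
  {W : ℕ → ℕ → Prop} {K : ℕ → Prop}

theorem addUnits_spec (he : EnvOK n u v env) (hM : Tables n E Sm M)
    (hK : ∀ p < 2 * n, M 7 p ≠ 0 ↔ K p)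
    (h0 : ∀ p < 2 * n, ∀ q < 2 * n, ¬ Conf n M p q)
    (hunit : ∀ p < 2 * n, K (neg n p) ∨ Sm (neg n p) → W p p) :
    ConfInv n W M (addUnits.run 2 env M) ∧
      ∀ p < 2 * n, K (neg n p) ∨ Sm (neg n p) → Conf n (addUnits.run 2 env M) p p := by
  have hinit : ConfInv n W M M := ⟨fun _ _ => rfl, fun p hp q hq h => absurd h (h0 p hp q hq),
    fun p hp q hq h => absurd h (h0 p hp q hq)⟩
  have step : ∀ j < env 2, ∀ M', ConfInv n W M M' →
      ConfInv n W M (Prog.run 3 (Function.update env 5 j) M' (.cond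
        (.add (.read 7 (.read 9 (.var 5))) (.read 4 (.read 9 (.var 5))))
        (.store 8 (.add (.read 6 (.var 5)) (.var 5)) (.const 1)))) ∧
      (K (neg n j) ∨ Sm (neg n j) → Conf n (Prog.run 3 (Function.update env 5 j) M' (.cond
        (.add (.read 7 (.read 9 (.var 5))) (.read 4 (.read 9 (.var 5))))
        (.store 8 (.add (.read 6 (.var 5)) (.var 5)) (.const 1)))) j j) := by
    intro j hj M' hM'
    rw [he.lits] at hj
    have hc : (Expr.add (.read 7 (.read 9 (.var 5))) (.read 4 (.read 9 (.var 5)))).eval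
        ⟨Function.update env 5 j, M'⟩ ≠ 0 ↔ K (neg n j) ∨ Sm (neg n j) := by
      simp only [Expr.eval, Function.update_self, hM'.frame 9 (by norm_num),
        hM'.frame 7 (by norm_num), hM'.frame 4 (by norm_num), hM.neg j hj,
        ← hK _ (neg_lt hj), ← hM.sample _ (neg_lt hj)]
      omega
    by_cases h : K (neg n j) ∨ Sm (neg n j)
    · rw [Prog.run_cond_pos (hc.mpr h)]
      simp only [Prog.run, Expr.eval, Function.update_self, hM'.frame 6 (by norm_num),
        hM.offLit j hj]
      refine ⟨⟨fun a ha => ?_, fun p hp q hq hpq => ?_, fun p hp q hq hpq => ?_⟩, fun _ => ?_⟩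
      · rw [← hM'.frame a ha]; simp [Mem.set, ha]
      · rw [conf_set hq hj] at hpq
        rcases hpq with ⟨rfl, rfl⟩ | hpq
        · exact hunit _ hp h
        · exact hM'.sound p hp q hq hpq
      · rw [conf_set hq hj] at hpq
        rw [conf_set hp hj]
        exact hpq.imp (fun h => h.symm) (hM'.symm p hp q hq)
      · rw [conf_set hj hj]; simp
    · rw [Prog.run_cond_neg (hc.not.mpr h)]
      exact ⟨hM', fun h' => absurd h' h⟩
  refine ⟨Prog.run_loop_inv (ConfInv n W M) hinit fun j hj M' hM' => (step j hj M' hM').1, ?_⟩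
  intro p hp h
  obtain ⟨M', hM', hg⟩ := Prog.run_loop_visit (a := 8) (d := 2) (N := 2) (env := env) (M := M)
    (p := .cond (.add (.read 7 (.read 9 (.var 5))) (.read 4 (.read 9 (.var 5))))
      (.store 8 (.add (.read 6 (.var 5)) (.var 5)) (.const 1)))
    (by simp [Prog.SetsOne]) (ConfInv n W M) hinit (fun j hj M' hM' => (step j hj M' hM').1) p
    (by rw [he.lits]; exact hp)
  exact hg _ ((step p (by rw [he.lits]; exact hp) M' hM').2 h)

/-- The invariant `ConfInv` passes through all four loops. The clauses of a fixed quadruple are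
present at the end because conflicts are never erased, as `run_loop_visit` records at each level. -/
theorem addClauses_spec (he : EnvOK n u v env) (hW : ∀ p q, W p q → W q p)
    (hM₀ : Tables n E Sm M₀) (hK : ∀ p < 2 * n, M₀ 7 p ≠ 0 ↔ K p) (hM : ConfInv n W M₀ M)
    (hpairs : ∀ a < n, ∀ b < n, ∀ c < n, ∀ d < n, E a b → E c d → a ≠ c → ¬ E a c →
      PairClauses K W a (b + n) c (d + n) ∧ PairClauses K W (a + n) b (c + n) d) :
    ConfInv n W M₀ (addClauses.run 2 env M) ∧ Grows 8 M (addClauses.run 2 env M) ∧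
    ∀ a < n, ∀ b < n, ∀ c < n, ∀ d < n, E a b → E c d → a ≠ c → ¬ E a c →
      PairClauses K (Conf n (addClauses.run 2 env M)) a (b + n) c (d + n) ∧
      PairClauses K (Conf n (addClauses.run 2 env M)) (a + n) b (c + n) d := by
  have q4 : ∀ a < n, ∀ b < n, ∀ c < n, ∀ d < n, ∀ M', ConfInv n W M₀ M' → _ :=
    fun a ha b hb c hc d hd M' hM' => addQuadruple_spec (M := M') (k := 6)
      (e := Function.update (Function.update (Function.update (Function.update env 5 a) 6 b) 7 c)
        8 d) hW hM₀ hK hM' (by simp [he.size]) (by simp) (by simp) (by simp) (by simp) ha hb hc hd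
      (hpairs a ha b hb c hc d hd)
  have s4 : addQuadruple.SetsOne 8 := addQuadruple_setsOne
  have q3 : ∀ a < n, ∀ b < n, ∀ c < n, ∀ M', ConfInv n W M₀ M' →
      ConfInv n W M₀ (Prog.run 5 (Function.update (Function.update (Function.update env 5 a)
        6 b) 7 c) M' (.loop 0 addQuadruple)) :=
    fun a ha b hb c hc M' hM' => Prog.run_loop_inv (ConfInv n W M₀) hM' fun d hd M'' hM'' =>
      (q4 a ha b hb c hc d (by simpa [he.size] using hd) M'' hM'').1
  have q2 : ∀ a < n, ∀ b < n, ∀ M', ConfInv n W M₀ M' →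
      ConfInv n W M₀ (Prog.run 4 (Function.update (Function.update env 5 a) 6 b) M'
        (.loop 0 (.loop 0 addQuadruple))) :=
    fun a ha b hb M' hM' => Prog.run_loop_inv (ConfInv n W M₀) hM' fun c hc M'' hM'' =>
      q3 a ha b hb c (by simpa [he.size] using hc) M'' hM''
  have q1 : ∀ a < n, ∀ M', ConfInv n W M₀ M' →
      ConfInv n W M₀ (Prog.run 3 (Function.update env 5 a) M'
        (.loop 0 (.loop 0 (.loop 0 addQuadruple)))) :=
    fun a ha M' hM' => Prog.run_loop_inv (ConfInv n W M₀) hM' fun b hb M'' hM'' =>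
      q2 a ha b (by simpa [he.size] using hb) M'' hM''
  refine ⟨Prog.run_loop_inv (ConfInv n W M₀) hM fun a ha M' hM' =>
    q1 a (by simpa [he.size] using ha) M' hM',
    Prog.SetsOne.grows (p := addClauses) s4 2 env M, ?_⟩
  intro a ha b hb c hc d hd hab hcd hac hnac
  obtain ⟨M1, h1, g1⟩ := Prog.run_loop_visit (a := 8) (d := 2) (N := 0) (env := env) (M := M)
    (p := .loop 0 (.loop 0 (.loop 0 addQuadruple))) s4 (ConfInv n W M₀) hM
    (fun a ha M' hM' => q1 a (by simpa [he.size] using ha) M' hM') a (by simpa [he.size] using ha)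
  obtain ⟨M2, h2, g2⟩ := Prog.run_loop_visit (a := 8) (d := 3) (N := 0)
    (env := Function.update env 5 a) (M := M1) (p := .loop 0 (.loop 0 addQuadruple)) s4
    (ConfInv n W M₀) h1 (fun b hb M' hM' => q2 a ha b (by simpa [he.size] using hb) M' hM') b
    (by simpa [he.size] using hb)
  obtain ⟨M3, h3, g3⟩ := Prog.run_loop_visit (a := 8) (d := 4) (N := 0)
    (env := Function.update (Function.update env 5 a) 6 b) (M := M2) (p := .loop 0 addQuadruple)
    s4 (ConfInv n W M₀) h2
    (fun c hc M' hM' => q3 a ha b hb c (by simpa [he.size] using hc) M' hM') c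
    (by simpa [he.size] using hc)
  obtain ⟨M4, h4, g4⟩ := Prog.run_loop_visit (a := 8) (d := 5) (N := 0)
    (env := Function.update (Function.update (Function.update env 5 a) 6 b) 7 c) (M := M3)
    (p := addQuadruple) s4 (ConfInv n W M₀) h3
    (fun d hd M' hM' => (q4 a ha b hb c hc d (by simpa [he.size] using hd) M' hM').1) d
    (by simpa [he.size] using hd)
  obtain ⟨r1, r2⟩ := (q4 a ha b hb c hc d hd M4 h4).2 hab hcd hac hnac
  exact ⟨r1.mono fun p q h => g1 _ (g2 _ (g3 _ (g4 _ h))),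
    r2.mono fun p q h => g1 _ (g2 _ (g3 _ (g4 _ h)))⟩

/-- Resolution on the literal `z`. -/
def ResolvesAt (n : ℕ) (R : ℕ → ℕ → Prop) (z : ℕ) : Prop :=
  ∀ p < 2 * n, ∀ q < 2 * n, R p z → R (neg n z) q → R p q

/-- One round of the closure. -/
def closeRound : Prog :=
  .loop 2 (.loop 2 (.cond (confE (.var 6) (.var 5))
    (.cond (confE (.read 9 (.var 5)) (.var 7))
      (.store 8 (.add (.read 6 (.var 6)) (.var 7)) (.const 1)))))

/-- Updating in place is harmless: resolving on `z` adds nothing to column `z` or to row `neg n z`,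
the only entries that the tests of this round read. -/
theorem closeRound_spec {z : ℕ} (hz : z < 2 * n) (h2 : env 2 = 2 * n) (h5 : env 5 = z)
    (hM₀ : Tables n E Sm M₀) (hM : ∀ a, a ≠ 8 → M a = M₀ a) :
    (∀ a, a ≠ 8 → closeRound.run 3 env M a = M₀ a) ∧
    ∀ p < 2 * n, ∀ q < 2 * n, Conf n (closeRound.run 3 env M) p q ↔
      Conf n M p q ∨ (Conf n M p z ∧ Conf n M (neg n z) q) := by
  set J : Mem → Prop := fun M' => (∀ a, a ≠ 8 → M' a = M₀ a) ∧ ∀ p < 2 * n, ∀ q < 2 * n,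
    (Conf n M p q → Conf n M' p q) ∧
    (Conf n M' p q → Conf n M p q ∨ (Conf n M p z ∧ Conf n M (neg n z) q)) with hJ
  have hnz := neg_lt hz
  have hinit : J M := ⟨hM, fun p _ q _ => ⟨id, Or.inl⟩⟩
  have body : ∀ p < 2 * n, ∀ q < 2 * n, ∀ M', J M' →
      J (Prog.run 5 (Function.update (Function.update env 6 p) 7 q) M'
        (.cond (confE (.var 6) (.var 5)) (.cond (confE (.read 9 (.var 5)) (.var 7))
          (.store 8 (.add (.read 6 (.var 6)) (.var 7)) (.const 1))))) ∧
      (Conf n M p z → Conf n M (neg n z) q →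
      Conf n (Prog.run 5 (Function.update (Function.update env 6 p) 7 q) M'
        (.cond (confE (.var 6) (.var 5)) (.cond (confE (.read 9 (.var 5)) (.var 7))
          (.store 8 (.add (.read 6 (.var 6)) (.var 7)) (.const 1))))) p q) := by
    rintro p hp q hq M' ⟨hf, hc⟩
    have c1 : (confE (.var 6) (.var 5)).eval
        ⟨Function.update (Function.update env 6 p) 7 q, M'⟩ ≠ 0 ↔ Conf n M p z := by
      have : Conf n M' p z ↔ Conf n M p z := ⟨fun h => by
        have := (hc p hp z hz).2 h; tauto, (hc p hp z hz).1⟩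
      rw [← this]
      simp [confE, Expr.eval, h5, hf 6, hM₀.offLit p hp, Conf]
    have c2 : (confE (.read 9 (.var 5)) (.var 7)).eval
        ⟨Function.update (Function.update env 6 p) 7 q, M'⟩ ≠ 0 ↔ Conf n M (neg n z) q := by
      have : Conf n M' (neg n z) q ↔ Conf n M (neg n z) q := ⟨fun h => by
        have := (hc _ hnz q hq).2 h; tauto, (hc _ hnz q hq).1⟩
      rw [← this]
      simp [confE, Expr.eval, h5, hf 6, hf 9, hM₀.neg z hz, hM₀.offLit _ hnz, Conf]
    by_cases e1 : Conf n M p z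
    swap
    · rw [Prog.run_cond_neg (c1.not.mpr e1)]
      exact ⟨⟨hf, hc⟩, fun h => absurd h e1⟩
    rw [Prog.run_cond_pos (c1.mpr e1)]
    by_cases e2 : Conf n M (neg n z) q
    swap
    · rw [Prog.run_cond_neg (c2.not.mpr e2)]
      exact ⟨⟨hf, hc⟩, fun _ h => absurd h e2⟩
    rw [Prog.run_cond_pos (c2.mpr e2)]
    have hrun : Prog.run 5 (Function.update (Function.update env 6 p) 7 q) M'
        (.store 8 (.add (.read 6 (.var 6)) (.var 7)) (.const 1)) =
        M'.set 8 (p * (2 * n) + q) 1 := by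
      simp [Prog.run, Expr.eval, hf 6, hM₀.offLit p hp]
    rw [hrun]
    refine ⟨⟨fun a ha => ?_, fun r hr s hs => ?_⟩, fun _ _ => ?_⟩
    · rw [← hf a ha]; simp [Mem.set, ha]
    · rw [conf_set hs hq]
      refine ⟨fun h => Or.inr ((hc r hr s hs).1 h), ?_⟩
      rintro (⟨rfl, rfl⟩ | h)
      · exact Or.inr ⟨e1, e2⟩
      · exact (hc r hr s hs).2 h
    · rw [conf_set hq hq]; simp
  have row : ∀ p < 2 * n, ∀ M', J M' → J (Prog.run 4 (Function.update env 6 p) M'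
        (.loop 2 (.cond (confE (.var 6) (.var 5)) (.cond (confE (.read 9 (.var 5)) (.var 7))
          (.store 8 (.add (.read 6 (.var 6)) (.var 7)) (.const 1)))))) :=
    fun p hp M' hM' => Prog.run_loop_inv J hM' fun q hq M'' hM'' =>
      (body p hp q (by simpa [h2] using hq) M'' hM'').1
  have hend : J (closeRound.run 3 env M) := Prog.run_loop_inv J hinit fun p hp M' hM' =>
    row p (by simpa [h2] using hp) M' hM'
  refine ⟨hend.1, fun p hp q hq => ⟨(hend.2 p hp q hq).2, ?_⟩⟩
  rintro (h | ⟨hpz, hzq⟩)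
  · exact (hend.2 p hp q hq).1 h
  · obtain ⟨M1, j1, g1⟩ := Prog.run_loop_visit (a := 8) (d := 3) (N := 2) (env := env) (M := M)
      (p := .loop 2 (.cond (confE (.var 6) (.var 5)) (.cond (confE (.read 9 (.var 5)) (.var 7))
          (.store 8 (.add (.read 6 (.var 6)) (.var 7)) (.const 1)))))
      (by simp [Prog.SetsOne]) J hinit
      (fun p hp M' hM' => row p (by simpa [h2] using hp) M' hM') p (by simpa [h2] using hp)
    obtain ⟨M2, j2, g2⟩ := Prog.run_loop_visit (a := 8) (d := 4) (N := 2)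
      (env := Function.update env 6 p) (M := M1)
      (p := .cond (confE (.var 6) (.var 5)) (.cond (confE (.read 9 (.var 5)) (.var 7))
          (.store 8 (.add (.read 6 (.var 6)) (.var 7)) (.const 1))))
      (by simp [Prog.SetsOne]) J j1
      (fun q hq M' hM' => (body p hp q (by simpa [h2] using hq) M' hM').1) q
      (by simpa [h2] using hq)
    exact g1 _ (g2 _ ((body p hp q hq M2 j2).2 hpz hzq))

/-- As in Warshall's algorithm, one pass over the pivots suffices, since a round preserves closure
at the pivots already treated. The last conjunct, minimality among closed relations, is used later
to derive both soundness and symmetry of the closure. -/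
theorem closeConf_spec (he : EnvOK n u v env) (hM₀ : Tables n E Sm M₀)
    (hM : ∀ a, a ≠ 8 → M a = M₀ a) :
    (∀ a, a ≠ 8 → closeConf.run 2 env M a = M₀ a) ∧
    (∀ p < 2 * n, ∀ q < 2 * n, Conf n M p q → Conf n (closeConf.run 2 env M) p q) ∧
    (∀ z < 2 * n, ResolvesAt n (Conf n (closeConf.run 2 env M)) z) ∧
    ∀ W : ℕ → ℕ → Prop, (∀ p < 2 * n, ∀ q < 2 * n, Conf n M p q → W p q) →
      (∀ z < 2 * n, ResolvesAt n W z) →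
      ∀ p < 2 * n, ∀ q < 2 * n, Conf n (closeConf.run 2 env M) p q → W p q := by
  have key := Prog.run_loop (d := 2) (N := 2) (env := env) (M := M) (p := closeRound)
    (fun k M' => (∀ a, a ≠ 8 → M' a = M₀ a) ∧
    (∀ p < 2 * n, ∀ q < 2 * n, Conf n M p q → Conf n M' p q) ∧
    (∀ z < k, ResolvesAt n (Conf n M') z) ∧
    ∀ W : ℕ → ℕ → Prop, (∀ p < 2 * n, ∀ q < 2 * n, Conf n M p q → W p q) →
      (∀ z < 2 * n, ResolvesAt n W z) →
      ∀ p < 2 * n, ∀ q < 2 * n, Conf n M' p q → W p q) ?_ ?_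
  · rw [he.lits] at key
    exact key
  · exact ⟨hM, fun _ _ _ _ h => h, by simp, fun W hW _ => hW⟩
  · rintro z hz M' ⟨hf, hg, hr, hs⟩
    rw [he.lits] at hz
    obtain ⟨hf', hc⟩ := closeRound_spec (env := Function.update env (3 + 2) z) (M := M') hz
      (by simp [he.lits]) (by simp) hM₀ hf
    refine ⟨hf', fun p hp q hq h => (hc p hp q hq).mpr (Or.inl (hg p hp q hq h)), ?_, ?_⟩
    · intro j hj p hp q hq hpj hjq
      have hj2 : j < 2 * n := by omega
      have hnz := neg_lt hz
      have hnj := neg_lt hj2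
      rw [hc p hp j hj2] at hpj
      rw [hc _ hnj q hq] at hjq
      rw [hc p hp q hq]
      rcases Nat.lt_succ_iff_lt_or_eq.mp hj with h | rfl
      · have t := hr j h
        rcases hpj with hpj | ⟨a1, a2⟩ <;> rcases hjq with hjq | ⟨b1, b2⟩
        · exact Or.inl (t p hp q hq hpj hjq)
        · exact Or.inr ⟨t p hp z hz hpj b1, b2⟩
        · exact Or.inr ⟨a1, t _ hnz q hq a2 hjq⟩
        · exact Or.inr ⟨a1, b2⟩
      · tauto
    · intro W hW1 hW2 p hp q hq h
      rcases (hc p hp q hq).mp h with h | ⟨h1, h2⟩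
      · exact hs W hW1 hW2 p hp q hq h
      · exact hW2 z hz p hp q hq (hs W hW1 hW2 p hp z hz h1)
          (hs W hW1 hW2 _ (neg_lt hz) q hq h2)

theorem setTrue_spec {p : ℕ} (hp : p < 2 * n) (h2 : env 2 = 2 * n) (h5 : env 5 = p)
    (hM₀ : Tables n E Sm M₀) (hM : ∀ a, a ≠ 10 → M a = M₀ a) {q : ℕ} (hq : q < 2 * n) :
    setTrue.run 3 env M 10 q ≠ 0 ↔ M 10 q ≠ 0 ∨ q = p ∨ Conf n M₀ p (neg n q) := by
  set c : Prog := .cond (confE (.var 5) (.read 9 (.var 6))) (.store 10 (.var 6) (.const 1)) with hc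
  set J : Mem → Prop := fun M' => (∀ a, a ≠ 10 → M' a = M₀ a) ∧ ∀ q < 2 * n,
    (M 10 q ≠ 0 → M' 10 q ≠ 0) ∧ (M' 10 q ≠ 0 → M 10 q ≠ 0 ∨ Conf n M₀ p (neg n q)) with hJ
  have hinit : J M := ⟨hM, fun q _ => ⟨id, Or.inl⟩⟩
  have body : ∀ r < env 2, ∀ M', J M' → J (c.run 4 (Function.update env 6 r) M') ∧
      (Conf n M₀ p (neg n r) → c.run 4 (Function.update env 6 r) M' 10 r ≠ 0) := by
    rintro r hr M' ⟨hf, hv⟩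
    rw [h2] at hr
    have c1 : (confE (.var 5) (.read 9 (.var 6))).eval ⟨Function.update env 6 r, M'⟩ ≠ 0 ↔
        Conf n M₀ p (neg n r) := by
      simp [confE, Expr.eval, h5, hf 8, hf 6, hf 9, hM₀.neg r hr, hM₀.offLit p hp, Conf]
    by_cases e : Conf n M₀ p (neg n r)
    · rw [hc, Prog.run_cond_pos (c1.mpr e)]
      simp only [Prog.run, Expr.eval, Function.update_self]
      refine ⟨⟨fun a ha => ?_, fun q hq => ?_⟩, fun _ => by simp⟩
      · rw [← hf a ha]; simp [Mem.set, ha]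
      · have := hv q hq
        rw [Mem.set_apply]
        by_cases hqr : q = r
        · subst hqr; simp [e]
        · simpa [hqr] using this
    · rw [hc, Prog.run_cond_neg (c1.not.mpr e)]
      exact ⟨⟨hf, hv⟩, fun h => absurd h e⟩
  have hend : J ((Prog.loop 2 c).run 3 env M) := Prog.run_loop_inv J hinit
    fun r hr M' hM' => (body r hr M' hM').1
  have hrun : setTrue.run 3 env M = ((Prog.loop 2 c).run 3 env M).set 10 p 1 := by
    rw [setTrue, Prog.run_seq]
    simp only [← hc]
    conv_lhs => simp only [Prog.run, Expr.eval, h5]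
    rfl
  rw [hrun, Mem.set_apply]
  by_cases hqp : q = p
  · simp [hqp]
  · rw [if_neg (by tauto)]
    constructor
    · intro h
      rcases (hend.2 q hq).2 h with h | h <;> tauto
    · rintro (h | h | h)
      · exact (hend.2 q hq).1 h
      · exact absurd h hqp
      · obtain ⟨M', j', g⟩ := Prog.run_loop_visit (a := 10) (d := 3) (N := 2) (env := env) (M := M)
          (p := c) (by simp [hc, Prog.SetsOne]) J hinit
          (fun r hr M' hM' => (body r hr M' hM').1) q (by rw [h2]; exact hq)
        exact g _ ((body q (by rw [h2]; exact hq) M' j').2 h)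

/-- The true literals stay consistent and closed under implication. Thanks to resolution, a new
literal only needs its direct consequences, and no backtracking occurs: a literal without
self-conflict whose variable is undecided can always be added. -/
theorem greedy_spec (he : EnvOK n u v env) (hM : Tables n E Sm M)
    (hval : ∀ p < 2 * n, M 10 p = 0)
    (hsymm : ∀ p < 2 * n, ∀ q < 2 * n, Conf n M p q → Conf n M q p)
    (hres : ∀ z < 2 * n, ResolvesAt n (Conf n M) z) :
    (∀ p < 2 * n, ¬ (greedy.run 2 env M 10 p ≠ 0 ∧ greedy.run 2 env M 10 (neg n p) ≠ 0)) ∧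
    (∀ p < 2 * n, ∀ q < 2 * n, greedy.run 2 env M 10 p ≠ 0 → Conf n M p q →
      greedy.run 2 env M 10 (neg n q) ≠ 0) ∧
    ∀ p < 2 * n, greedy.run 2 env M 10 p ≠ 0 ∨ greedy.run 2 env M 10 (neg n p) ≠ 0 ∨
      Conf n M p p := by
  have key := Prog.run_loop (d := 2) (N := 2) (env := env) (M := M)
    (p := .cond (.sub (.const 1) (.add (.add (.read 10 (.var 5)) (.read 10 (.read 9 (.var 5))))
    (confE (.var 5) (.var 5)))) setTrue)
    (fun k M' => (∀ a, a ≠ 10 → M' a = M a) ∧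
      (∀ p < 2 * n, ¬ (M' 10 p ≠ 0 ∧ M' 10 (neg n p) ≠ 0)) ∧
      (∀ p < 2 * n, ∀ q < 2 * n, M' 10 p ≠ 0 → Conf n M p q → M' 10 (neg n q) ≠ 0) ∧
      ∀ p < k, M' 10 p ≠ 0 ∨ M' 10 (neg n p) ≠ 0 ∨ Conf n M p p) ?_ ?_
  · rw [he.lits] at key
    exact key.2
  · refine ⟨fun _ _ => rfl, fun p hp h => h.1 (hval p hp), fun p hp q _ h => absurd (hval p hp) h,
      by simp⟩
  · rintro p hp M' ⟨hf, hcons, hclos, htot⟩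
    rw [he.lits] at hp
    have hnp := neg_lt hp
    have c1 : (Expr.sub (.const 1) (.add (.add (.read 10 (.var 5)) (.read 10 (.read 9 (.var 5))))
        (confE (.var 5) (.var 5)))).eval ⟨Function.update env 5 p, M'⟩ ≠ 0 ↔
        M' 10 p = 0 ∧ M' 10 (neg n p) = 0 ∧ ¬ Conf n M p p := by
      simp only [confE, Expr.eval, Function.update_self, hf 8 (by norm_num), hf 6 (by norm_num),
        hf 9 (by norm_num), hM.neg p hp, hM.offLit p hp, Conf]
      omega
    by_cases e : M' 10 p = 0 ∧ M' 10 (neg n p) = 0 ∧ ¬ Conf n M p p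
    · rw [Prog.run_cond_pos (c1.mpr e)]
      obtain ⟨e1, e2, e3⟩ := e
      have hv : ∀ q < 2 * n, setTrue.run (2 + 1) (Function.update env (3 + 2) p) M' 10 q ≠ 0 ↔
          M' 10 q ≠ 0 ∨ q = p ∨ Conf n M p (neg n q) := fun q hq =>
        setTrue_spec hp (by simp [he.lits]) (by simp) hM hf hq
      refine ⟨fun a ha => ?_, fun q hq => ?_, fun q hq r hr hvq hqr => ?_, fun q hq => ?_⟩
      · rw [← hf a ha]
        refine Prog.run_frame _ _ _ _ _ ?_
        simpa [setTrue, Prog.writes] using ha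
      · have hnq := neg_lt hq
        rw [hv q hq, hv _ hnq, neg_neg' hq]
        -- Each of `q` and its negation is old, equal to `p`, or forced by `p`. An old literal in
        -- conflict with `p` would have made `neg n p` true already. If both are forced by `p`,
        -- resolution makes `p` conflict with itself.
        rintro ⟨h1 | rfl | h1, h2 | h2 | h2⟩
        · exact hcons q hq ⟨h1, h2⟩
        · rw [← h2, neg_neg' hq] at e2; exact h1 e2
        · exact hclos q hq p hp h1 (hsymm _ hp _ hq h2) e2
        · exact h2 e2
        · unfold neg at h2; split_ifs at h2 <;> omega
        · exact e3 h2
        · exact hclos _ hnq p hp h2 (hsymm _ hp _ hnq h1) e2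
        · rw [h2] at h1; exact e3 h1
        · have := hres (neg n q) hnq p hp p hp h1
          rw [neg_neg' hq] at this
          exact e3 (this (hsymm _ hp _ hq h2))
      · have hnr := neg_lt hr
        rw [hv _ hnr, neg_neg' hr]
        rcases (hv q hq).mp hvq with h1 | rfl | h1
        · exact Or.inl (hclos q hq r hr h1 hqr)
        · exact Or.inr (Or.inr hqr)
        · have := hres (neg n q) (neg_lt hq) p hp r hr h1
          rw [neg_neg' hq] at this
          exact Or.inr (Or.inr (this hqr))
      · have hq2 : q < 2 * n := by omega
        rw [hv q hq2, hv _ (neg_lt hq2)]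
        rcases Nat.lt_succ_iff_lt_or_eq.mp hq with h | rfl
        · have := htot q h; tauto
        · tauto
    · rw [Prog.run_cond_neg (c1.not.mpr e)]
      refine ⟨hf, hcons, hclos, fun q hq => ?_⟩
      rcases Nat.lt_succ_iff_lt_or_eq.mp hq with h | rfl
      · exact htot q h
      · tauto

theorem checkNone_spec {d : ℕ} {e : Expr} {B : ℕ → Prop} (h0 : env 0 = n)
    (he : ∀ x < n, ∀ M', (∀ a, a ≠ 11 → M' a = M a) →
      (e.eval ⟨Function.update env (3 + d) x, M'⟩ ≠ 0 ↔ B x)) :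
    ((checkNone e).run d env M 11 0 ≠ 0 ↔ ∀ x < n, ¬ B x) ∧
      ∀ a, a ≠ 11 → (checkNone e).run d env M a = M a := by
  have key := Prog.run_loop (d := d) (N := 0) (env := env) (M := M.set 11 0 1)
    (p := .cond e (.store 11 (.const 0) (.const 0)))
    (fun k M' => (M' 11 0 ≠ 0 ↔ ∀ x < k, ¬ B x) ∧ ∀ a, a ≠ 11 → M' a = M a)
    ⟨by simp, fun a ha => by simp [Mem.set, ha]⟩ (by
      rintro x hx M' ⟨h1, h2⟩
      rw [h0] at hx
      have c := he x hx M' h2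
      by_cases hB : B x
      · rw [Prog.run_cond_pos (c.mpr hB)]
        simp only [Prog.run, Expr.eval]
        refine ⟨?_, fun a ha => by rw [← h2 a ha]; simp [Mem.set, ha]⟩
        simp only [Mem.set_same, ne_eq, not_true_eq_false, false_iff]
        intro h
        exact h x (by omega) hB
      · rw [Prog.run_cond_neg (c.not.mpr hB)]
        refine ⟨h1.trans ⟨fun h y hy => ?_, fun h y hy => h y (by omega)⟩, h2⟩
        rcases Nat.lt_succ_iff_lt_or_eq.mp hy with h' | rfl
        · exact h y h'
        · exact hB)
  rw [h0] at key
  exact key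

theorem publish_spec (he : EnvOK n u v env) :
    ((∀ x < n, M 10 x ≠ 0 ∨ M 10 (x + n) ≠ 0) ∧
      ∀ x < n, publish.run 2 env M 3 x = 1 ↔ M 10 x ≠ 0) ∨
    ((∃ x < n, M 10 x = 0 ∧ M 10 (x + n) = 0) ∧ publish.run 2 env M 3 = M 3) := by
  have hcheck := checkNone_spec (n := n) (d := 2) (env := env) (M := M)
    (e := .sub (.const 1) (.add (.read 10 (.var 5)) (.read 10 (.add (.var 5) (.var 0)))))
    (B := fun x => M 10 x = 0 ∧ M 10 (x + n) = 0) he.size (by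
      intro x hx M' hM'
      simp [Expr.eval, he.size, hM' 10]
      omega)
  set M1 := (checkNone (.sub (.const 1) (.add (.read 10 (.var 5))
    (.read 10 (.add (.var 5) (.var 0)))))).run 2 env M with hM1
  rw [publish, Prog.run_seq, ← hM1]
  have hc : (Expr.read 11 (.const 0)).eval ⟨env, M1⟩ ≠ 0 ↔
      ∀ x < n, ¬ (M 10 x = 0 ∧ M 10 (x + n) = 0) := hcheck.1
  by_cases h : ∀ x < n, ¬ (M 10 x = 0 ∧ M 10 (x + n) = 0)
  · left
    refine ⟨fun x hx => by have := h x hx; tauto, ?_⟩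
    rw [Prog.run_cond_pos (hc.mpr h)]
    have key := Prog.run_loop_forall (d := 2) (N := 0) (env := env) (M := M1)
      (p := .store 3 (.var 5) (.sub (.const 1) (.sub (.const 1) (.read 10 (.var 5)))))
      (fun M' => M' 10 = M 10) (fun x M' => M' 3 x = 1 ↔ M 10 x ≠ 0) (hcheck.2 10 (by norm_num))
      (by
        intro x hx M' hM'
        simp only [Prog.run, Expr.eval, Nat.reduceAdd, Function.update_self, hM']
        refine ⟨by simp [Mem.set, hM'], by rw [Mem.set_same]; omega, fun y _ hy hy' => ?_⟩
        rw [Mem.set_apply, if_neg (by tauto)]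
        exact hy')
    have h2 := key.2
    rwa [he.size] at h2
  · right
    rw [Prog.run_cond_neg (hc.not.mpr h)]
    push Not at h
    exact ⟨h, hcheck.2 3 (by norm_num)⟩

end Phases

theorem PairClauses.mono_of_lt {N : ℕ} {K : ℕ → Prop} {W W' : ℕ → ℕ → Prop} {A B C D : ℕ}
    (h : PairClauses K W A B C D) (hA : A < N) (hB : B < N) (hC : C < N) (hD : D < N)
    (hW : ∀ p < N, ∀ q < N, W p q → W' p q) : PairClauses K W' A B C D :=
  ⟨fun x y => hW _ hA _ hC (h.1 x y), fun x y => hW _ hA _ hB (h.2.1 x y),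
    fun x y => hW _ hB _ hD (h.2.2.1 x y), fun x y => hW _ hA _ hD (h.2.2.2 x y)⟩

/-! ### The search for one cut edge and over all cut edges -/

section Solve

variable {n u v : ℕ} {env : ℕ → ℕ} {E : ℕ → ℕ → Prop} {Sm : ℕ → Prop} {M : Mem}

/-- Soundness of every conflict for all solutions shows that failure is genuine. The binary and unit
clauses, through `sol_of_pairs`, show that a complete greedy assignment is a solution. -/
theorem solve_spec (he : EnvOK n u v env) (hM : Tables n E Sm M) (hE : ∀ i j, E i j → E j i)
    (hu : u < n) (hv : v < n) (huv : E u v) :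
    (∃ T, Sol n E Sm u v T ∧ ∀ x < n, solve.run 2 env M 3 x = 1 ↔ T x) ∨
    (solve.run 2 env M 3 = M 3 ∧ ¬ ∃ T, Sol n E Sm u v T) := by
  set M1 := clearConf.run 2 env M with hM1
  set M2 := clearVal.run 2 env M1 with hM2
  set M3 := computeKnown.run 2 env M2 with hM3
  set M4 := addUnits.run 2 env M3 with hM4
  set M5 := addClauses.run 2 env M4 with hM5
  set M6 := closeConf.run 2 env M5 with hM6
  set M7 := greedy.run 2 env M6 with hM7
  have hrun : solve.run 2 env M = publish.run 2 env M7 := rfl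
  have f1 : ∀ a, a ≠ 8 → M1 a = M a := fun a ha =>
    Prog.run_frame _ _ _ _ _ (by simpa [clearConf, Prog.writes] using ha)
  have f2 : ∀ a, a ≠ 10 → M2 a = M1 a := fun a ha =>
    Prog.run_frame _ _ _ _ _ (by simpa [clearVal, Prog.writes] using ha)
  have f3 : ∀ a, a ≠ 7 → M3 a = M2 a := fun a ha =>
    Prog.run_frame _ _ _ _ _ (by simpa [computeKnown, Prog.writes] using ha)
  have f7 : ∀ a, a ≠ 10 → M7 a = M6 a := fun a ha =>
    Prog.run_frame _ _ _ _ _ (by simpa [greedy, setTrue, Prog.writes] using ha)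
  have t2 : Tables n E Sm M2 := hM.congr (by
    intro a ha
    simp only [List.mem_cons, List.not_mem_nil, or_false] at ha
    rw [f2 a (by omega), f1 a (by omega)])
  have t3 : Tables n E Sm M3 := t2.congr (by
    intro a ha
    simp only [List.mem_cons, List.not_mem_nil, or_false] at ha
    rw [f3 a (by omega)])
  have hK : ∀ p < 2 * n, M3 7 p ≠ 0 ↔ Known n E u v p := fun p hp =>
    computeKnown_spec he t2 hu hv hp
  have hempty : ∀ p < 2 * n, ∀ q < 2 * n, ¬ Conf n M3 p q := by
    intro p hp q hq
    rw [conf_congr (M := M1) (by rw [f3 8 (by norm_num), f2 8 (by norm_num)])]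
    exact clearConf_spec he hM hp hq
  -- The semantic conflict relation: it contains every stored clause and is closed under resolution,
  -- so it bounds the computed closure.
  set W : ℕ → ℕ → Prop := fun p q => ∀ T, Sol n E Sm u v T → ¬ (T p ∧ T q) with hW
  have hWs : ∀ p q, W p q → W q p := fun p q h T hT h' => h T hT h'.symm
  obtain ⟨i4, unit4⟩ := addUnits_spec (W := W) he t3 hK hempty (by
    rintro p hp h T hT ⟨hTp, -⟩
    have hn : T (neg n p) := by
      rcases h with h | h
      · exact hT.known hE hu hv huv (neg_lt hp) h
      · exact hT.sample _ (neg_lt hp) h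
    exact (hT.compl p hp).mp hn hTp)
  obtain ⟨i5, g5, pairs5⟩ := addClauses_spec he hWs t3 hK i4 (by
    intro a ha b hb c hc d hd hab hcd hac hnac
    have hk : ∀ T, Sol n E Sm u v T → ∀ p < 2 * n, Known n E u v p → T p :=
      fun T hT p hp => hT.known hE hu hv huv hp
    constructor
    · have pc := fun T (hT : Sol n E Sm u v T) => pairClauses_of_not_all
        (hT.border a ha b hb c hc d hd hab hcd hac hnac).1 (hk T hT a (by omega))
        (hk T hT (b + n) (by omega)) (hk T hT c (by omega)) (hk T hT (d + n) (by omega))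
      exact ⟨fun h h' T hT => (pc T hT).1 h h', fun h h' T hT => (pc T hT).2.1 h h',
        fun h h' T hT => (pc T hT).2.2.1 h h', fun h h' T hT => (pc T hT).2.2.2 h h'⟩
    · have pc := fun T (hT : Sol n E Sm u v T) => pairClauses_of_not_all
        (hT.border a ha b hb c hc d hd hab hcd hac hnac).2 (hk T hT (a + n) (by omega))
        (hk T hT b (by omega)) (hk T hT (c + n) (by omega)) (hk T hT d (by omega))
      exact ⟨fun h h' T hT => (pc T hT).1 h h', fun h h' T hT => (pc T hT).2.1 h h',
        fun h h' T hT => (pc T hT).2.2.1 h h', fun h h' T hT => (pc T hT).2.2.2 h h'⟩)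
  obtain ⟨f6, g6, res6, min6⟩ := closeConf_spec he t3 i5.frame
  rw [← hM6] at f6 g6 res6 min6
  have symm6 : ∀ p < 2 * n, ∀ q < 2 * n, Conf n M6 p q → Conf n M6 q p := by
    intro p hp q hq h
    -- The symmetric part of the closure contains the initial conflicts and is itself closed, so
    -- minimality makes it everything.
    refine (min6 (fun p q => Conf n M6 p q ∧ Conf n M6 q p) ?_ ?_ p hp q hq h).2
    · exact fun p hp q hq h => ⟨g6 p hp q hq h, g6 q hq p hp (i5.symm p hp q hq h)⟩
    · rintro z hz p hp q hq ⟨h1, h2⟩ ⟨h3, h4⟩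
      refine ⟨res6 z hz p hp q hq h1 h3, res6 (neg n z) (neg_lt hz) q hq p hp h4 ?_⟩
      rwa [neg_neg' hz]
  have sound6 : ∀ p < 2 * n, ∀ q < 2 * n, Conf n M6 p q → W p q := by
    refine min6 W i5.sound ?_
    rintro z hz p hp q hq h1 h2 T hT ⟨hTp, hTq⟩
    by_cases hz' : T z
    · exact h1 T hT ⟨hTp, hz'⟩
    · exact h2 T hT ⟨(hT.compl z hz).mpr hz', hTq⟩
  have t6 : Tables n E Sm M6 := t3.congr (by
    intro a ha
    simp only [List.mem_cons, List.not_mem_nil, or_false] at ha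
    rw [f6 a (by omega)])
  have val6 : ∀ p < 2 * n, M6 10 p = 0 := by
    intro p hp
    rw [f6 10 (by norm_num), f3 10 (by norm_num)]
    exact clearVal_spec he hp
  obtain ⟨cons7, clos7, tot7⟩ := greedy_spec he t6 val6 symm6 res6
  rw [← hM7] at cons7 clos7 tot7
  have noconf : ∀ p < 2 * n, ∀ q < 2 * n, Conf n M6 p q → ¬ (M7 10 p ≠ 0 ∧ M7 10 q ≠ 0) :=
    fun p hp q hq h h' => cons7 q hq ⟨h'.2, clos7 p hp q hq h'.1 h⟩
  rw [hrun]
  rcases publish_spec (M := M7) he with ⟨hall, hout⟩ | ⟨⟨x, hx, hx1, hx2⟩, hout⟩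
  · left
    refine ⟨fun p => M7 10 p ≠ 0, ?_, hout⟩
    have compl : ∀ p < 2 * n, M7 10 (neg n p) ≠ 0 ↔ ¬ M7 10 p ≠ 0 := by
      intro p hp
      refine ⟨fun h h' => cons7 p hp ⟨h', h⟩, fun h => ?_⟩
      by_cases hpn : p < n
      · have := hall p hpn
        rw [neg_of_lt hpn]
        tauto
      · obtain ⟨y, rfl⟩ : ∃ y, p = y + n := ⟨p - n, by omega⟩
        have := hall y (by omega)
        rw [neg_add]
        tauto
    have hunit : ∀ p < 2 * n, Known n E u v p ∨ Sm p → M7 10 p ≠ 0 := by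
      intro p hp h
      have hnp := neg_lt hp
      -- A forced literal was encoded as a self-conflict of its negation, so the negation is not set
      -- and completeness sets the literal itself.
      have h1 := g6 _ hnp _ hnp (g5 _ (unit4 (neg n p) hnp (by rwa [neg_neg' hp])))
      have h2 := (compl _ hnp).mpr fun h => noconf _ hnp _ hnp h1 ⟨h, h⟩
      rwa [neg_neg' hp] at h2
    refine sol_of_pairs hE hu hv huv compl (fun p hp h => hunit p hp (Or.inr h))
      (fun p hp h => hunit p hp (Or.inl h)) ?_
    intro a ha b hb c hc d hd hab hcd hac hnac
    obtain ⟨p1, p2⟩ := pairs5 a ha b hb c hc d hd hab hcd hac hnac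
    have hmono : ∀ p < 2 * n, ∀ q < 2 * n, Conf n M5 p q → ¬ (M7 10 p ≠ 0 ∧ M7 10 q ≠ 0) :=
      fun p hp q hq h => noconf p hp q hq (g6 p hp q hq h)
    exact ⟨p1.mono_of_lt (by omega) (by omega) (by omega) (by omega) hmono,
      p2.mono_of_lt (by omega) (by omega) (by omega) (by omega) hmono⟩
  · right
    refine ⟨?_, ?_⟩
    · rw [hout, f7 3 (by norm_num), f6 3 (by norm_num), f3 3 (by norm_num), f2 3 (by norm_num),
        f1 3 (by norm_num)]
    · rintro ⟨T, hT⟩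
      have hx' : x < 2 * n := by omega
      have hxn : x + n < 2 * n := by omega
      have k1 := tot7 x hx'
      have k2 := tot7 (x + n) hxn
      rw [neg_of_lt hx] at k1
      rw [neg_add] at k2
      -- A vertex left undecided by the greedy phase has both literals in conflict with themselves,
      -- so no solution can decide it.
      have w1 : W x x := sound6 x hx' x hx' (by tauto)
      have w2 : W (x + n) (x + n) := sound6 _ hxn _ hxn (by tauto)
      have n1 : ¬ T x := fun h => w1 T hT ⟨h, h⟩
      have n2 : ¬ T (x + n) := fun h => w2 T hT ⟨h, h⟩
      have := hT.compl x hx'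
      rw [neg_of_lt hx] at this
      exact n2 (this.mpr n1)

/-! ### The whole program -/

/-- Tries all edges as cut edges. -/
def tryEdges : Prog := .loop 0 (.loop 0 (.cond (adjE (.var 3) (.var 4)) solve))

/-- The output of `M'` is a solution for some cut edge, or it is that of `M` and the cut edges
in `Done` have no solution. -/
def Tried (n : ℕ) (E : ℕ → ℕ → Prop) (Sm : ℕ → Prop) (M M' : Mem) (Done : ℕ → ℕ → Prop) : Prop :=
  (∃ u < n, ∃ v < n, E u v ∧ ∃ T, Sol n E Sm u v T ∧ ∀ x < n, M' 3 x = 1 ↔ T x) ∨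
  (M' 3 = M 3 ∧ ∀ u v, Done u v → E u v → ¬ ∃ T, Sol n E Sm u v T)

/-- A success overwrites the whole output with a solution and a failure leaves it untouched, so it
does not matter which solvable edge writes last. -/
theorem tryEdges_spec (h0 : env 0 = n) (h2 : env 2 = 2 * n) (hM : Tables n E Sm M)
    (hE : ∀ i j, E i j → E j i) :
    Tried n E Sm M (tryEdges.run 0 env M) (fun u v => u < n ∧ v < n) := by
  have key := Prog.run_loop (d := 0) (N := 0) (env := env) (M := M)
    (p := .loop 0 (.cond (adjE (.var 3) (.var 4)) solve))
    (fun k M' => Tables n E Sm M' ∧ Tried n E Sm M M' (fun u v => u < k ∧ v < n))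
    ⟨hM, Or.inr ⟨rfl, by simp⟩⟩ ?_
  · rw [h0] at key
    exact key.2
  · rintro u hu M1 ⟨t1, r1⟩
    rw [h0] at hu
    have inner := Prog.run_loop (d := 1) (N := 0) (env := Function.update env 3 u) (M := M1)
      (p := .cond (adjE (.var 3) (.var 4)) solve)
      (fun k M' => Tables n E Sm M' ∧
        Tried n E Sm M M' (fun u' v => u' < u ∧ v < n ∨ u' = u ∧ v < k))
      ⟨t1, by simpa using r1⟩ ?_
    · simp only [ne_eq, OfNat.zero_ne_ofNat, not_false_eq_true, Function.update_of_ne, h0] at inner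
      refine ⟨inner.1, inner.2.imp id fun h => ⟨h.1, fun u' v hd => h.2 u' v (by omega)⟩⟩
    · rintro v hv M2 ⟨t2, r2⟩
      simp only [ne_eq, OfNat.zero_ne_ofNat, not_false_eq_true, Function.update_of_ne, h0] at hv
      have he : EnvOK n u v (Function.update (Function.update env 3 u) (3 + 1) v) :=
        ⟨by simp [h0], by simp [h2], by simp, by simp⟩
      have hc : (adjE (.var 3) (.var 4)).eval
          ⟨Function.update (Function.update env 3 u) (3 + 1) v, M2⟩ ≠ 0 ↔ E u v := by
        simp only [adjE, Expr.eval, he.src, he.dst, t2.off u hu]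
        rcases t2.adj u hu v hv with h | h <;> simp [h]
      by_cases huv : E u v
      · rw [Prog.run_cond_pos (hc.mpr huv)]
        refine ⟨t2.congr ?_, ?_⟩
        · intro a ha
          simp only [List.mem_cons, List.not_mem_nil, or_false] at ha
          refine Prog.run_frame _ _ _ _ _ ?_
          simp only [solve, clearConf, clearVal, computeKnown, addUnits, addClauses, addQuadruple,
            addPairs, setConfIf, setConf, closeConf, greedy, setTrue, publish, checkNone,
            Prog.writes, List.mem_append, List.mem_singleton, not_or]
          omega
        · rcases solve_spec he t2 hE hu hv huv with h | ⟨h1, h2⟩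
          · exact Or.inl ⟨u, hu, v, hv, huv, h⟩
          · rcases r2 with ⟨u', hu', v', hv', e', T, hT, hTx⟩ | ⟨r, r'⟩
            · exact Or.inl ⟨u', hu', v', hv', e', T, hT, fun x hx => by
                rw [← hTx x hx, ← h1]⟩
            · refine Or.inr ⟨h1.trans r, fun u' v' hd he' => ?_⟩
              by_cases hh : u' = u ∧ v' = v
              · rw [hh.1, hh.2]; exact h2
              · exact r' u' v' (by omega) he'
      · rw [Prog.run_cond_neg (hc.not.mpr huv)]
        refine ⟨t2, r2.imp id fun h => ⟨h.1, fun u' v' hd he' => ?_⟩⟩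
        by_cases hh : u' = u ∧ v' = v
        · rw [hh.1, hh.2] at he'; exact absurd he' huv
        · exact h.2 u' v' (by omega) he'

/-- Computes row offsets and negations. -/
def makeTables : Prog :=
  .seq (.loop 0 (.store 5 (.add (.var 3) (.const 1)) (.add (.read 5 (.var 3)) (.var 0))))
    (.seq (.loop 2 (.store 6 (.add (.var 3) (.const 1)) (.add (.read 6 (.var 3)) (.var 2))))
      (.loop 0 (.seq (.store 9 (.var 3) (.add (.var 3) (.var 0)))
        (.store 9 (.add (.var 3) (.var 0)) (.var 3)))))

/-- The machine has no multiplication, so the multiples of the row length are tabulated by repeated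
addition. -/
theorem offsets_spec {a N : ℕ} (hN : N < 3) {k : ℕ} (hk : env N = k) (ha : M a 0 = 0) {i : ℕ}
    (hi : i < k) :
    (Prog.loop N (.store a (.add (.var 3) (.const 1)) (.add (.read a (.var 3)) (.var N)))).run 0
      env M a i = i * k := by
  have key := Prog.run_loop (d := 0) (N := N) (env := env) (M := M)
    (p := .store a (.add (.var 3) (.const 1)) (.add (.read a (.var 3)) (.var N)))
    (fun j M' => ∀ i ≤ j, M' a i = i * k) (by
      intro i hi
      rw [Nat.le_zero.mp hi, ha, Nat.zero_mul]) (by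
      intro j hj M' hM' i hi
      simp only [Prog.run, Expr.eval, Nat.add_zero, Function.update_self,
        Function.update_of_ne (show N ≠ 3 by omega), hk, Mem.set_apply, true_and]
      split_ifs with h
      · rw [h, hM' j le_rfl]; ring
      · exact hM' i (by omega))
  exact key i (by omega)

theorem makeTables_spec (h0 : env 0 = n) (h2 : env 2 = 2 * n) (h5 : M 5 0 = 0) (h6 : M 6 0 = 0)
    (hadj : ∀ i < n, ∀ j < n, (E i j ∧ M 0 (i * n + j) = 1) ∨ (¬ E i j ∧ M 0 (i * n + j) = 0))
    (hsample : ∀ p < 2 * n, M 4 p ≠ 0 ↔ Sm p) : Tables n E Sm (makeTables.run 0 env M) := by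
  have hf : ∀ a, a ≠ 5 → a ≠ 6 → a ≠ 9 → makeTables.run 0 env M a = M a := fun a h5 h6 h9 =>
    Prog.run_frame _ _ _ _ _ (by simp [makeTables, Prog.writes, h5, h6, h9])
  set p5 : Prog :=
    .loop 0 (.store 5 (.add (.var 3) (.const 1)) (.add (.read 5 (.var 3)) (.var 0))) with hp5
  set p6 : Prog :=
    .loop 2 (.store 6 (.add (.var 3) (.const 1)) (.add (.read 6 (.var 3)) (.var 2))) with hp6
  set p9 : Prog := .loop 0 (.seq (.store 9 (.var 3) (.add (.var 3) (.var 0)))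
    (.store 9 (.add (.var 3) (.var 0)) (.var 3))) with hp9
  have hrun : makeTables.run 0 env M = p9.run 0 env (p6.run 0 env (p5.run 0 env M)) := rfl
  constructor
  · rw [hf 0 (by norm_num) (by norm_num) (by norm_num)]; exact hadj
  · intro i hi
    rw [hrun, Prog.run_frame p9 _ _ _ _ (by simp [hp9, Prog.writes]),
      Prog.run_frame p6 _ _ _ _ (by simp [hp6, Prog.writes])]
    exact offsets_spec (by norm_num) h0 h5 hi
  · intro i hi
    rw [hrun, Prog.run_frame p9 _ _ _ _ (by simp [hp9, Prog.writes])]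
    refine offsets_spec (by norm_num) h2 ?_ hi
    rw [Prog.run_frame p5 _ _ _ _ (by simp [hp5, Prog.writes]), h6]
  · intro p hp
    have key := Prog.run_loop_forall (d := 0) (N := 0) (env := env)
      (M := p6.run 0 env (p5.run 0 env M))
      (p := .seq (.store 9 (.var 3) (.add (.var 3) (.var 0)))
        (.store 9 (.add (.var 3) (.var 0)) (.var 3))) (fun _ => True)
      (fun x M' => M' 9 x = x + n ∧ M' 9 (x + n) = x) trivial (by
        intro x hx M' _
        rw [h0] at hx
        have hr : Prog.run (0 + 1) (Function.update env (3 + 0) x) M'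
            (.seq (.store 9 (.var 3) (.add (.var 3) (.var 0)))
              (.store 9 (.add (.var 3) (.var 0)) (.var 3))) =
            (M'.set 9 x (x + n)).set 9 (x + n) x := by
          simp [Prog.run, Expr.eval, h0]
        rw [hr]
        simp only [Mem.set_apply, true_and]
        refine ⟨?_, fun y hy hyx hR => ?_⟩
        · rw [if_neg (by omega)]; simp
        · rw [h0] at hy
          rw [if_neg (by omega), if_neg (by omega), if_neg (by omega), if_neg (by omega)]
          exact hR)
    have h9 := key.2
    rw [h0] at h9
    rw [hrun]
    by_cases h : p < n
    · rw [neg_of_lt h]; exact (h9 p h).1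
    · obtain ⟨x, rfl⟩ : ∃ x, p = x + n := ⟨p - n, by omega⟩
      rw [neg_add]; exact (h9 x (by omega)).2
  · rw [hf 4 (by norm_num) (by norm_num) (by norm_num)]; exact hsample

/-- Outputs the full vertex set if there are no negative examples. -/
def initOutput : Prog :=
  .seq (checkNone (.read 4 (.add (.var 3) (.var 0))))
    (.cond (.read 11 (.const 0)) (.loop 0 (.store 3 (.var 3) (.const 1))))

theorem initOutput_spec (h0 : env 0 = n) :
    ((∀ x < n, M 4 (x + n) = 0) ∧ ∀ x < n, initOutput.run 0 env M 3 x = 1) ∨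
    ((∃ x < n, M 4 (x + n) ≠ 0) ∧ initOutput.run 0 env M 3 = M 3) := by
  have hcheck := checkNone_spec (n := n) (d := 0) (env := env) (M := M)
    (e := .read 4 (.add (.var 3) (.var 0))) (B := fun x => M 4 (x + n) ≠ 0) h0 (by
      intro x hx M' hM'
      simp [Expr.eval, h0, hM' 4])
  set M1 := (checkNone (.read 4 (.add (.var 3) (.var 0)))).run 0 env M with hM1
  rw [initOutput, Prog.run_seq, ← hM1]
  have hc : (Expr.read 11 (.const 0)).eval ⟨env, M1⟩ ≠ 0 ↔ ∀ x < n, ¬ M 4 (x + n) ≠ 0 := hcheck.1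
  by_cases h : ∀ x < n, ¬ M 4 (x + n) ≠ 0
  · left
    refine ⟨fun x hx => not_not.mp (h x hx), ?_⟩
    rw [Prog.run_cond_pos (hc.mpr h)]
    have key := Prog.run_loop_forall (d := 0) (N := 0) (env := env) (M := M1)
      (p := .store 3 (.var 3) (.const 1)) (fun _ => True) (fun x M' => M' 3 x = 1) trivial (by
        intro x hx M' _
        simp only [Prog.run, Expr.eval, Nat.add_zero, Function.update_self]
        refine ⟨trivial, by simp, fun y _ hy hy' => ?_⟩
        rw [Mem.set_apply, if_neg (by tauto)]
        exact hy')
    have h2 := key.2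
    rwa [h0] at h2
  · right
    rw [Prog.run_cond_neg (hc.not.mpr h)]
    push Not at h
    exact ⟨h, hcheck.2 3 (by norm_num)⟩

/-- Reads the examples. -/
def readSample : Prog :=
  .loop 1 (.seq (.cond (.read 2 (.var 3)) (.store 4 (.read 1 (.var 3)) (.const 1)))
    (.cond (.sub (.const 1) (.read 2 (.var 3)))
      (.store 4 (.add (.read 1 (.var 3)) (.var 0)) (.const 1))))

theorem readSample_spec {m : ℕ} (h0 : env 0 = n) (h1 : env 1 = m) (h4 : ∀ p, M 4 p = 0) (p : ℕ) :
    readSample.run 0 env M 4 p ≠ 0 ↔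
      ∃ k < m, (M 2 k ≠ 0 ∧ p = M 1 k) ∨ (M 2 k = 0 ∧ p = M 1 k + n) := by
  have key := Prog.run_loop (d := 0) (N := 1) (env := env) (M := M)
    (p := .seq (.cond (.read 2 (.var 3)) (.store 4 (.read 1 (.var 3)) (.const 1)))
      (.cond (.sub (.const 1) (.read 2 (.var 3)))
        (.store 4 (.add (.read 1 (.var 3)) (.var 0)) (.const 1))))
    (fun j M' => (∀ a, a ≠ 4 → M' a = M a) ∧ ∀ p, M' 4 p ≠ 0 ↔
      ∃ k < j, (M 2 k ≠ 0 ∧ p = M 1 k) ∨ (M 2 k = 0 ∧ p = M 1 k + n))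
    ⟨fun _ _ => rfl, fun p => by simp [h4]⟩ ?_
  · rw [h1] at key
    exact key.2 p
  · rintro j hj M' ⟨hf, hp⟩
    have hr : ∃ l, ((M 2 j ≠ 0 ∧ l = M 1 j) ∨ (M 2 j = 0 ∧ l = M 1 j + n)) ∧
        Prog.run (0 + 1) (Function.update env (3 + 0) j) M'
          (.seq (.cond (.read 2 (.var 3)) (.store 4 (.read 1 (.var 3)) (.const 1)))
            (.cond (.sub (.const 1) (.read 2 (.var 3)))
              (.store 4 (.add (.read 1 (.var 3)) (.var 0)) (.const 1)))) = M'.set 4 l 1 := by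
      by_cases h : M 2 j = 0
      · refine ⟨M 1 j + n, Or.inr ⟨h, rfl⟩, ?_⟩
        rw [Prog.run_seq, Prog.run_cond_neg (e := .read 2 (.var 3)) (by simp [Expr.eval, hf 2, h]),
          Prog.run_cond_pos (by simp [Expr.eval, hf 2, h])]
        simp [Prog.run, Expr.eval, hf 1, h0]
      · refine ⟨M 1 j, Or.inl ⟨h, rfl⟩, ?_⟩
        have h2 : ∀ k l, M'.set 4 k l 2 = M 2 := fun k l => by simp [Mem.set, hf 2]
        rw [Prog.run_seq, Prog.run_cond_pos (e := .read 2 (.var 3))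
          (by simp [Expr.eval, hf 2, h]), Prog.run_cond_neg (by
          simp only [Prog.run, Expr.eval, Nat.add_zero, Function.update_self, h2]; omega)]
        simp [Prog.run, Expr.eval, hf 1]
    obtain ⟨l, hl, hr⟩ := hr
    rw [hr]
    refine ⟨fun a ha => by rw [← hf a ha]; simp [Mem.set, ha], fun p => ?_⟩
    rw [Mem.set_apply]
    by_cases hpl : p = l
    · subst hpl
      simp only [and_self, if_true, ne_eq, one_ne_zero, not_false_eq_true, true_iff]
      exact ⟨j, by omega, hl⟩
    · rw [if_neg (by tauto), hp p]
      refine ⟨fun ⟨k, hk, h⟩ => ⟨k, by omega, h⟩, fun ⟨k, hk, h⟩ => ?_⟩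
      rcases Nat.lt_succ_iff_lt_or_eq.mp hk with hk' | rfl
      · exact ⟨k, hk', h⟩
      · exfalso; apply hpl; rcases h with h | h <;> rcases hl with hl | hl <;> omega

end Solve

/-- What is done after reading the examples. -/
def search : Prog := .seq makeTables (.seq initOutput tryEdges)

/-- The learning algorithm. -/
def learner : Cmd :=
  .seq (.assign 2 (.add (.var 0) (.var 0))) (.seq (readSample.compile 0) (search.compile 0))

theorem readSample_wf : readSample.WF 0 := by
  simp [readSample, Prog.WF, Expr.Below]

theorem search_wf : search.WF 0 := by
  simp [search, makeTables, initOutput, tryEdges, solve, clearConf, clearVal, computeKnown,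
    addUnits, addClauses, addQuadruple, addPairs, setConfIf, setConf, closeConf, greedy, setTrue,
    publish, checkNone, adjE, eqE, confE, Prog.WF, Expr.Below]

theorem search_boundsOK : search.BoundsOK := by
  simp [search, makeTables, initOutput, tryEdges, solve, clearConf, clearVal, computeKnown,
    addUnits, addClauses, addQuadruple, addPairs, setConfIf, setConf, closeConf, greedy, setTrue,
    publish, checkNone, Prog.BoundsOK]

/-! ### From literals back to halfspaces, and the learner -/

section Correctness

variable {n m : ℕ}

/-- Adjacency on natural numbers. -/
def natAdj (G : SimpleGraph (Fin n)) (i j : ℕ) : Prop :=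
  ∃ (hi : i < n) (hj : j < n), G.Adj ⟨i, hi⟩ ⟨j, hj⟩

/-- The literals forced by the examples. -/
def sampleLit (S : Fin m → Fin n × Bool) (p : ℕ) : Prop :=
  ∃ k, ((S k).2 = true ∧ p = (S k).1) ∨ ((S k).2 = false ∧ p = (S k).1 + n)

theorem natAdj_symm {G : SimpleGraph (Fin n)} (i j : ℕ) (h : natAdj G i j) : natAdj G j i :=
  let ⟨hi, hj, h⟩ := h
  ⟨hj, hi, h.symm⟩

/-- The literals that hold for a set of vertices. -/
def litOf (H : Set (Fin n)) (p : ℕ) : Prop :=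
  if h : p < n then ⟨p, h⟩ ∈ H else ∀ h : p - n < n, ⟨p - n, h⟩ ∉ H

theorem litOf_fin {H : Set (Fin n)} (x : Fin n) : litOf H x ↔ x ∈ H := by simp [litOf]

theorem litOf_add {H : Set (Fin n)} (x : Fin n) : litOf H (x + n) ↔ x ∉ H := by simp [litOf]

theorem sol_litOf {G : SimpleGraph (Fin n)} {S : Fin m → Fin n × Bool} {H : Set (Fin n)}
    (hH : BorderClique G H) (hHc : BorderClique G Hᶜ) (hS : Consistent H S) {u v : Fin n}
    (hu : u ∈ H) (hv : v ∉ H) : Sol n (natAdj G) (sampleLit S) u v (litOf H) := by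
  refine ⟨fun p hp => ?_, ?_, (litOf_fin u).mpr hu, (litOf_add v).mpr hv, ?_⟩
  · by_cases h : p < n
    · rw [neg_of_lt h, litOf_add ⟨p, h⟩, litOf_fin ⟨p, h⟩]
    · obtain ⟨x, rfl⟩ : ∃ x, p = x + n := ⟨p - n, by omega⟩
      have hx : x < n := by omega
      rw [neg_add, litOf_add ⟨x, hx⟩, litOf_fin ⟨x, hx⟩, not_not]
  · rintro p - ⟨k, ⟨h1, rfl⟩ | ⟨h1, rfl⟩⟩
    · exact (litOf_fin _).mpr ((hS k).mp h1)
    · rw [litOf_add]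
      intro h
      have := (hS k).mpr h
      simp [h1] at this
  · rintro a ha b hb c hc d hd ⟨_, _, hab⟩ ⟨_, _, hcd⟩ hac hnac
    have hne : (⟨a, ha⟩ : Fin n) ≠ ⟨c, hc⟩ := fun h => hac (Fin.mk.inj h)
    have hnadj : ¬ G.Adj ⟨a, ha⟩ ⟨c, hc⟩ := fun h => hnac ⟨ha, hc, h⟩
    rw [litOf_fin ⟨a, ha⟩, litOf_fin ⟨b, hb⟩, litOf_fin ⟨c, hc⟩, litOf_fin ⟨d, hd⟩,
      litOf_add ⟨a, ha⟩, litOf_add ⟨b, hb⟩, litOf_add ⟨c, hc⟩, litOf_add ⟨d, hd⟩]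
    exact ⟨fun ⟨h1, h2, h3, h4⟩ => hnadj (hH _ _ _ _ hab hcd h1 h2 h3 h4 hne),
      fun ⟨h1, h2, h3, h4⟩ => hnadj (hHc _ _ _ _ hab hcd h1 (not_not.mpr h2) h3
        (not_not.mpr h4) hne)⟩

theorem Sol.mHalfspace_and_consistent {G : SimpleGraph (Fin n)} {S : Fin m → Fin n × Bool}
    {u v : ℕ} {T : ℕ → Prop} (hT : Sol n (natAdj G) (sampleLit S) u v T) :
    {x : Fin n | T x} ∈ mHalfspaces G ∧ Consistent {x : Fin n | T x} S := by
  have hc : ∀ x : Fin n, T (x + n) ↔ ¬ T x := by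
    intro x
    have := hT.compl x (by omega)
    rwa [neg_of_lt x.2] at this
  have hb : ∀ a b c d : Fin n, G.Adj a b → G.Adj c d → a ≠ c → ¬ G.Adj a c → _ :=
    fun a b c d hab hcd hne hnadj => hT.border a a.2 b b.2 c c.2 d d.2 ⟨a.2, b.2, hab⟩
      ⟨c.2, d.2, hcd⟩ (fun h => hne (Fin.ext h)) (fun ⟨_, _, h⟩ => hnadj h)
  refine ⟨⟨BorderClique.mConvex ?_, BorderClique.mConvex ?_⟩, fun k => ?_⟩
  · intro a b c d hab hcd h1 h2 h3 h4 hne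
    by_contra hnadj
    exact (hb a b c d hab hcd hne hnadj).1 ⟨h1, (hc b).mpr h2, h3, (hc d).mpr h4⟩
  · intro a b c d hab hcd h1 h2 h3 h4 hne
    by_contra hnadj
    exact (hb a b c d hab hcd hne hnadj).2 ⟨(hc a).mpr h1, not_not.mp h2, (hc c).mpr h3,
      not_not.mp h4⟩
  · constructor
    · intro h
      exact hT.sample _ (by have := (S k).1.2; omega) ⟨k, Or.inl ⟨h, rfl⟩⟩
    · intro h
      by_contra h'
      have := hT.sample ((S k).1 + n) (by have := (S k).1.2; omega)
        ⟨k, Or.inr ⟨by simpa using h', rfl⟩⟩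
      exact (hc _).mp this h

theorem univ_mem_mHalfspaces (G : SimpleGraph (Fin n)) : Set.univ ∈ mHalfspaces G :=
  ⟨fun _ _ _ _ => Set.subset_univ _, fun _ h => absurd (Set.mem_univ _) h⟩

theorem empty_mem_mHalfspaces (G : SimpleGraph (Fin n)) : ∅ ∈ mHalfspaces G := by
  have := compl_mem_mHalfspaces (univ_mem_mHalfspaces G)
  rwa [Set.compl_univ] at this

/-- The output is a halfspace, and it is consistent with the examples if some halfspace is. -/
theorem search_correct {G : SimpleGraph (Fin n)} (hG : G.Connected) (S : Fin m → Fin n × Bool)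
    {env : ℕ → ℕ} (h0 : env 0 = n) (h1 : env 1 = m) (h2 : env 2 = 2 * n) {s : State}
    (hs : s.arr = search.run 0 env (readSample.run 0 env (inputState G S).arr)) :
    outputSet n s ∈ mHalfspaces G ∧
      ((∃ H ∈ mHalfspaces G, Consistent H S) → Consistent (outputSet n s) S) := by
  set M := (inputState G S).arr with hM
  set M1 := readSample.run 0 env M with hM1
  set M2 := makeTables.run 0 env M1 with hM2
  set M3 := initOutput.run 0 env M2 with hM3
  have hs' : s.arr = tryEdges.run 0 env M3 := hs
  have f1 : ∀ a, a ≠ 4 → M1 a = M a := fun a ha =>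
    Prog.run_frame _ _ _ _ _ (by simpa [readSample, Prog.writes] using ha)
  have f2 : M2 3 = M1 3 := Prog.run_frame _ _ _ _ _ (by simp [makeTables, Prog.writes])
  have f3 : ∀ a, a ≠ 3 → a ≠ 11 → M3 a = M2 a := fun a ha ha' =>
    Prog.run_frame _ _ _ _ _ (by simp [initOutput, checkNone, Prog.writes, ha, ha'])
  have sample1 : ∀ p, M1 4 p ≠ 0 ↔ sampleLit S p := by
    intro p
    rw [readSample_spec h0 h1 (fun p => rfl)]
    have e1 : ∀ k : Fin m, M 1 k = (S k).1 := fun k => by simp [hM, inputState]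
    have e2 : ∀ k : Fin m, M 2 k = (S k).2.toNat := fun k => by simp [hM, inputState]
    constructor
    · rintro ⟨k, hk, h⟩
      refine ⟨⟨k, hk⟩, ?_⟩
      have e1' := e1 ⟨k, hk⟩
      have e2' := e2 ⟨k, hk⟩
      simp only at e1' e2'
      rw [e1', e2'] at h
      cases hb : (S ⟨k, hk⟩).2 <;> simp_all
    · rintro ⟨k, h⟩
      refine ⟨k, k.2, ?_⟩
      rw [e1, e2]
      cases hb : (S k).2 <;> simp_all
  have t2 : Tables n (natAdj G) (sampleLit S) M2 := by
    refine makeTables_spec h0 h2 ?_ ?_ ?_ fun p _ => sample1 p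
    · rw [f1 5 (by norm_num)]; rfl
    · rw [f1 6 (by norm_num)]; rfl
    · intro i hi j hj
      rw [f1 0 (by norm_num)]
      by_cases h : G.Adj ⟨i, hi⟩ ⟨j, hj⟩
      · left
        refine ⟨⟨hi, hj, h⟩, if_pos ⟨⟨i, hi⟩, ⟨j, hj⟩, h, rfl⟩⟩
      · right
        refine ⟨fun ⟨_, _, h'⟩ => h h', if_neg ?_⟩
        rintro ⟨a, b, hab, heq⟩
        obtain ⟨ha, hb⟩ := (index_inj hj b.2).mp heq
        subst ha hb
        exact h hab
  have t3 : Tables n (natAdj G) (sampleLit S) M3 := t2.congr (by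
    intro a ha
    simp only [List.mem_cons, List.not_mem_nil, or_false] at ha
    exact f3 a (by omega) (by omega))
  have hout : outputSet n s = {x : Fin n | tryEdges.run 0 env M3 3 x = 1} := by
    rw [outputSet, hs']
  rcases tryEdges_spec h0 h2 t3 natAdj_symm with ⟨u, hu, v, hv, huv, T, hT, hTx⟩ | ⟨h3, hno⟩
  · have : outputSet n s = {x : Fin n | T x} := by
      rw [hout]; ext x; exact hTx x x.2
    rw [this]
    exact ⟨hT.mHalfspace_and_consistent.1, fun _ => hT.mHalfspace_and_consistent.2⟩
  -- No cut edge is solvable, so the output is still the initial one: the full set without negative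
  -- examples, and otherwise the empty set that the zeroed memory encodes.
  · rcases initOutput_spec (M := M2) h0 with ⟨hpos, h1⟩ | ⟨⟨x, hx, hx4⟩, h1⟩
    · have : outputSet n s = Set.univ := by
        rw [hout, h3]; ext x; simpa using h1 x x.2
      rw [this]
      refine ⟨univ_mem_mHalfspaces G, fun _ k => ?_⟩
      simp only [Set.mem_univ, iff_true]
      by_contra h
      refine absurd (hpos (S k).1 (S k).1.2) ?_
      exact (t2.sample _ (by have := (S k).1.2; omega)).mpr ⟨k, Or.inr ⟨by simpa using h, rfl⟩⟩
    · have hempty : outputSet n s = ∅ := by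
        rw [hout, h3, hM3, h1, f2, f1 3 (by norm_num)]
        ext x
        simp [hM, inputState]
      rw [hempty]
      refine ⟨empty_mem_mHalfspaces G, ?_⟩
      rintro ⟨H, hH, hHS⟩
      have hxH : (⟨x, hx⟩ : Fin n) ∉ H := by
        obtain ⟨k, ⟨-, hk⟩ | ⟨hk1, hk2⟩⟩ := (t2.sample _ (by omega)).mp hx4
        · have := (S k).1.2; omega
        · have hxk : (S k).1 = ⟨x, hx⟩ := Fin.ext (by simp only; omega)
          intro h
          have := (hHS k).mpr (hxk ▸ h)
          simp [hk1] at this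
      -- A nonempty `H` missing `x` would, by connectedness, have a boundary edge, and that edge
      -- would be a solvable cut edge.
      have hHe : H = ∅ := by
        by_contra hne
        obtain ⟨y, hy⟩ := Set.nonempty_iff_ne_empty.mpr hne
        obtain ⟨w⟩ := hG y ⟨x, hx⟩
        obtain ⟨d, -, hd1, hd2⟩ := w.exists_boundary_dart H hy hxH
        obtain ⟨hb, hbc⟩ := (mem_mHalfspaces_iff hG).mp hH
        exact hno d.fst d.snd ⟨d.fst.2, d.snd.2⟩ ⟨d.fst.2, d.snd.2, d.adj⟩
          ⟨_, sol_litOf hb hbc hHS hd1 hd2⟩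
      rwa [hHe] at hHS

theorem learner_spec : ∃ (p : Polynomial ℕ) (c : ℕ), ∀ (n : ℕ) (G : SimpleGraph (Fin n)),
    G.Connected → ∀ (m : ℕ) (S : Fin m → Fin n × Bool), ∃ H : Set (Fin n),
      OutputsInTime learner G S H (p.eval n + c * m) ∧ H ∈ mHalfspaces G ∧
      ((∃ H' ∈ mHalfspaces G, Consistent H' S) → Consistent H S) := by
  obtain ⟨q, hq⟩ := Prog.exists_cost_poly search search_boundsOK
  have hc : ∀ env : ℕ → ℕ, readSample.cost env = 2 + (env 1 * 28 + 4) := fun _ => rfl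
  -- Computing `2 * n` costs 4 and the reading loop costs 6 besides its rounds, giving 10. Each
  -- example is charged 20 for the loop body and 8 for the test and the increment.
  refine ⟨q + 10, 28, fun n G hG m S => ?_⟩
  set env : ℕ → ℕ := Function.update (inputState G S).var 2 (n + n) with henv
  have e0 : env 0 = n := by simp [henv, inputState]
  have e1 : env 1 = m := by simp [henv, inputState]
  have e2 : env 2 = 2 * n := by simp [henv]; omega
  have r0 : Runs (.assign 2 (.add (.var 0) (.var 0))) (inputState G S)
      ⟨env, (inputState G S).arr⟩ 4 := Runs.assign _ _ _
  obtain ⟨s1, t1, r1, ht1, ha1, hv1⟩ := Prog.compile_runs readSample 0 env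
    ⟨env, (inputState G S).arr⟩ readSample_wf fun _ _ => rfl
  obtain ⟨s2, t2, r2, ht2, ha2, hv2⟩ := Prog.compile_runs search 0 env s1 search_wf hv1
  rw [ha1] at ha2
  obtain ⟨h1, h2⟩ := search_correct hG S e0 e1 e2 ha2
  refine ⟨outputSet n s2, ⟨s2, 4 + (t1 + t2), Runs.seq r0 (Runs.seq r1 r2), ?_, rfl⟩, h1, h2⟩
  rw [hc, e1] at ht1
  rw [hq env n e0 e2] at ht2
  simp only [Polynomial.eval_add, Polynomial.eval_ofNat]
  omega

end Correctness

end MonoPAC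

end

theorem mainTheorem3 :
    ∃ (P : MonoPAC.Cmd)
      (A : (n m : ℕ) → SimpleGraph (Fin n) → (Fin m → Fin n × Bool) → Set (Fin n))
      (p : Polynomial ℕ) (c : ℕ) (C : ℝ), 0 < C ∧
      ∀ (n : ℕ) (G : SimpleGraph (Fin n)), G.Connected →
        (∀ (m : ℕ) (S : Fin m → Fin n × Bool),
          MonoPAC.OutputsInTime P G S (A n m G S) (p.eval n + c * m)) ∧
        ∀ ε δ : ℝ, 0 < ε → ε < 1 → 0 < δ → δ < 1 → ∀ m : ℕ,
          C * ((G.cliqueNum * Real.log (2 / ε) + Real.log (1 / δ)) / ε) ≤ m →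
          MonoPAC.PACLearnsRealizable (MonoPAC.mHalfspaces G) m (A n m G) ε δ := by
  classical
  obtain ⟨p, c, h⟩ := MonoPAC.learner_spec
  -- `A` names the set that the program leaves in memory; on disconnected graphs its value is
  -- arbitrary.
  choose! A hA using fun (n m : ℕ) (G : SimpleGraph (Fin n)) (S : Fin m → Fin n × Bool)
    (hG : G.Connected) => h n G hG m S
  refine ⟨MonoPAC.learner, A, p, c, 200, by norm_num, fun n G hG => ⟨fun m S =>
    (hA n m G S hG).1, fun ε δ hε hε1 hδ hδ1 m hm => ?_⟩⟩
  exact MonoPAC.pacLearns_of_consistent hG (fun S => (hA n m G S hG).2.1)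
    (fun S => (hA n m G S hG).2.2) hε hε1 hδ hδ1 hm
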